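/- Let $k$ be a field of characteristic zero, let $n\ge 12$, and let $\mathfrak g$ be a filiform Lie algebra of dimension $n$ over $k$, i.e. $\dim\mathfrak g=n$ and, for the lower central series $\mathfrak g^0=\mathfrak g$, $\mathfrak g^{i}=[\mathfrak g^{i-1},\mathfrak g]$ $(i\ge 1)$, one has $\mathfrak g^{n-1}=0$ and $\mathfrak g^{n-2}\neq 0$. Suppose that the law of $\mathfrak g$ lies in $\mathcal A_n^2$, that is, $\mathfrak g$ satisfies (a) and (b) but not (c), where (a) $\mathfrak g$ contains no subspace $U\supseteq\mathfrak g^1$ of codimension one with $[U,\mathfrak g^1]\subseteq\mathfrak g^4$; (b) if $n$ is even, then $\mathfrak g^{(n-4)/2}$ is abelian; (c) $[\mathfrak g^1,\mathfrak g^1]\subseteq\mathfrak g^6$. Then $\mathfrak g$ admits a non-singular prederivation if and only if it admits a non-singular derivation. Here a prederivation of $\mathfrak g$ is a linear map $P:\mathfrak g\to\mathfrak g$ with $$P([x,[y,z]])=[P(x),[y,z]]+[x,[P(y),z]]+[x,[y,P(z)]]\qquad\text{for all }x,y,z\in\mathfrak g,$$ and a linear map is non-singular if it is bijective. -/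

import Mathlib

namespace Filiform

section

variable (k : Type*) (L : Type*) [Field k] [LieRing L] [LieAlgebra k L]

/-- A prederivation of `L`: a linear map `P` with
`P [x,[y,z]] = [P x,[y,z]] + [x,[P y,z]] + [x,[y,P z]]`. -/
def IsPrederivation {k : Type*} {L : Type*} [Field k] [LieRing L] [LieAlgebra k L]
    (P : L →ₗ[k] L) : Prop :=
  ∀ x y z : L, P ⁅x, ⁅y, z⁆⁆ = ⁅P x, ⁅y, z⁆⁆ + ⁅x, ⁅P y, z⁆⁆ + ⁅x, ⁅y, P z⁆⁆

/-- `L` admits a non-singular (bijective) prederivation. -/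
def HasNonsingularPrederivation : Prop :=
  ∃ P : L →ₗ[k] L, IsPrederivation P ∧ Function.Bijective P

/-- `L` admits a non-singular (bijective) derivation. -/
def HasNonsingularDerivation : Prop :=
  ∃ D : LieDerivation k L L, Function.Bijective D

/-- The lower central series of `L`, starting with `lcs k L 0 = ⊤`
and `lcs k L (i + 1) = [L, lcs k L i]`. -/
abbrev lcs (i : ℕ) : LieIdeal k L :=
  LieModule.lowerCentralSeries k L L i

/-- `L` is nilpotent of nilindex `p`: `p` is the least index at which the lower central
series vanishes. -/
def HasNilindex (p : ℕ) : Prop :=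
  lcs k L p = ⊥ ∧ ∀ q < p, lcs k L q ≠ ⊥

/-- `L` is a filiform Lie algebra of dimension `n`, i.e. nilpotent of dimension `n` and
nilindex `n - 1`. -/
def IsFiliform (n : ℕ) : Prop :=
  Module.Finite k L ∧ Module.finrank k L = n ∧ ∃ p : ℕ, p + 1 = n ∧ HasNilindex k L p

/-- Property (a): there is no subspace `U` of codimension one containing `L^1` such that
`[U, L^1] ⊆ L^4`. -/
def PropertyA : Prop :=
  ¬ ∃ U : Submodule k L,
    (lcs k L 1).toSubmodule ≤ U ∧
    Module.finrank k (L ⧸ U) = 1 ∧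
    ∀ x ∈ U, ∀ y ∈ lcs k L 1, ⁅x, y⁆ ∈ lcs k L 4

/-- Property (b) for an algebra of dimension `n`: if `n` is even, then `L^m` is abelian for
`m = (n - 4) / 2`. -/
def PropertyB (n : ℕ) : Prop :=
  ∀ m : ℕ, n = 2 * m + 4 → IsLieAbelian (lcs k L m)

/-- Property (c): `[L^1, L^1] ⊆ L^6`. -/
def PropertyC : Prop :=
  ⁅lcs k L 1, lcs k L 1⁆ ≤ lcs k L 6

/-- The law of `L` belongs to the class `A_n^2`: `L` is filiform of dimension `n` and
satisfies (a) and (b), but not (c). -/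
def InClassA2 (n : ℕ) : Prop :=
  IsFiliform k L n ∧ PropertyA k L ∧ PropertyB k L n ∧ ¬ PropertyC k L

end

end Filiform

/-! A derivation is a prederivation, so only one direction has content. It rests on the fact that
the associated graded algebra of `L` is the truncated Witt algebra `[e_i, e_j] = (j - i) e_{i+j}`.

Complete the lower central series by the two-step centralizer `U` to a flag `F 1 = L`, `F 2 = U`, `F
(i + 2) = L^i`. A Vergne-type argument (`lie_mem_add`) gives `[F i, F j] ⊆ F (i + j)`; property (b)
is needed only in the top odd degree. By (a), a basis can be normalized to `[e_1, e_i] = (i - 1)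
e_{i+1}` and `[e_2, e_3] ≡ e_5`. The remaining leading coefficients satisfy polynomial Jacobi
relations. As (c) fails, `[e_3, e_4]` has non-zero leading coefficient, and the relations up to
degree 12 then have only the Witt solution (`structureConstants_low`); higher degrees follow by
induction.

On such an algebra a prederivation is triangular with diagonal `a, 2a, ..., na`
(`exists_prederivation_sub_mem`). If it is injective then `a ≠ 0`, the eigenvalues are distinct, and
an eigenbasis `f_i` has exactly homogeneous triple brackets. These almost determine the ordinary
brackets: the errors sit in the last few degrees and are removed by a change of basis
(`hasNonsingularDerivation_of_triple`). So `L` is itself the truncated Witt algebra, and `e_i ↦ i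
e_i` is a non-singular derivation. -/

namespace Filiform

/-! ### Complete flags, Witt-adapted bases and the degree derivation. -/

section Flag

variable {k : Type*} {L : Type*} [Field k] [LieRing L] [LieAlgebra k L]

/-- A descending complete flag `F 1 = ⊤ > F 2 > ... > F n > F (n + 1) = ⊥`. -/
structure IsFullFlag (n : ℕ) (F : ℕ → Submodule k L) : Prop where
  anti : Antitone F
  top : F 1 = ⊤
  finrank : ∀ i, 1 ≤ i → Module.finrank k (F i) = n + 1 - i

theorem exists_sub_smul_mem_of_finrank [Module.Finite k L] {A B : Submodule k L} (hAB : A ≤ B)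
    (hd : Module.finrank k B ≤ Module.finrank k A + 1) {g : L} (hgB : g ∈ B) (hgA : g ∉ A)
    {x : L} (hx : x ∈ B) : ∃ c : k, x - c • g ∈ A := by
  have hlt : A < A ⊔ Submodule.span k {g} := by
    refine lt_of_le_of_ne le_sup_left fun h => hgA ?_
    rw [h]
    exact Submodule.mem_sup_right (Submodule.mem_span_singleton_self g)
  have hle : A ⊔ Submodule.span k {g} ≤ B :=
    sup_le hAB ((Submodule.span_singleton_le_iff_mem _ _).2 hgB)
  have h1 := Submodule.finrank_lt_finrank_of_lt hlt
  have heq := Submodule.eq_of_le_of_finrank_le hle (by omega)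
  rw [← heq, Submodule.mem_sup] at hx
  obtain ⟨a, ha, b, hb, rfl⟩ := hx
  obtain ⟨c, rfl⟩ := Submodule.mem_span_singleton.1 hb
  exact ⟨c, by simpa using ha⟩

namespace IsFullFlag

variable {n : ℕ} {F : ℕ → Submodule k L}

theorem mem_of_le (hF : IsFullFlag n F) {i j : ℕ} (h : i ≤ j) {x : L} (hx : x ∈ F j) : x ∈ F i :=
  hF.anti h hx

theorem mem_one (hF : IsFullFlag n F) (x : L) : x ∈ F 1 := by
  rw [hF.top]; trivial

variable [Module.Finite k L]

theorem eq_zero (hF : IsFullFlag n F) {i : ℕ} (hi : n < i) {x : L} (hx : x ∈ F i) : x = 0 := by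
  have h := hF.finrank i (by omega)
  have : F i = ⊥ := Submodule.finrank_eq_zero.1 (by omega)
  rw [this] at hx
  simpa using hx

theorem exists_mem_notMem (hF : IsFullFlag n F) {i : ℕ} (h1 : 1 ≤ i) (hi : i ≤ n) :
    ∃ z ∈ F i, z ∉ F (i + 1) := by
  by_contra! h
  have h2 : F i ≤ F (i + 1) := h
  have h3 := Submodule.finrank_mono h2
  rw [hF.finrank i h1, hF.finrank (i + 1) (by omega)] at h3
  omega

theorem exists_sub_smul_mem (hF : IsFullFlag n F) {i : ℕ} (h1 : 1 ≤ i) {g : L} (hg : g ∈ F i)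
    (hg' : g ∉ F (i + 1)) {x : L} (hx : x ∈ F i) : ∃ c : k, x - c • g ∈ F (i + 1) := by
  refine exists_sub_smul_mem_of_finrank (hF.anti (Nat.le_succ i)) ?_ hg hg' hx
  rw [hF.finrank i h1, hF.finrank (i + 1) (by omega)]
  omega

/-- A linear functional reading off the coefficient of `g` on `F i / F (i + 1)`. -/
theorem exists_functional (hF : IsFullFlag n F) {i : ℕ} (h1 : 1 ≤ i) {g : L} (hg : g ∈ F i)
    (hg' : g ∉ F (i + 1)) :
    ∃ ψ : L →ₗ[k] k, ψ g = 1 ∧ (∀ x ∈ F (i + 1), ψ x = 0) ∧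
      ∀ x ∈ F i, x - ψ x • g ∈ F (i + 1) := by
  obtain ⟨f, hf, hk⟩ := Submodule.exists_le_ker_of_notMem hg'
  have h0 : ∀ x ∈ F (i + 1), ((f g)⁻¹ • f) x = 0 := by
    intro x hx
    have : f x = 0 := hk hx
    simp [this]
  have hone : ((f g)⁻¹ • f) g = 1 := by simp [hf]
  refine ⟨(f g)⁻¹ • f, hone, h0, fun x hx => ?_⟩
  obtain ⟨c, hc⟩ := hF.exists_sub_smul_mem h1 hg hg' hx
  have h2 := h0 _ hc
  rw [map_sub, map_smul, hone, smul_eq_mul, mul_one, sub_eq_zero] at h2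
  rwa [h2]

end IsFullFlag

/-- The elements `e i` are adapted to the flag `F`, the flag is a Lie algebra filtration, and the
leading terms of the brackets are those of the Witt algebra. -/
structure IsWittAdapted (n : ℕ) (F : ℕ → Submodule k L) (e : ℕ → L) : Prop where
  flag : IsFullFlag n F
  lie : ∀ {i j : ℕ} {x y : L}, 1 ≤ i → 1 ≤ j → x ∈ F i → y ∈ F j → ⁅x, y⁆ ∈ F (i + j)
  mem : ∀ i, 1 ≤ i → e i ∈ F i
  notMem : ∀ i, 1 ≤ i → i ≤ n → e i ∉ F (i + 1)
  bracket : ∀ i j, 1 ≤ i → 1 ≤ j → ⁅e i, e j⁆ - ((j : k) - i) • e (i + j) ∈ F (i + j + 1)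

namespace IsWittAdapted

variable {n : ℕ} {F : ℕ → Submodule k L} {e : ℕ → L}

theorem eq_zero_of_smul_mem (h : IsWittAdapted n F e) {i : ℕ} (h1 : 1 ≤ i) (hi : i ≤ n) {c : k}
    (hc : c • e i ∈ F (i + 1)) : c = 0 := by
  by_contra h0
  exact h.notMem i h1 hi ((Submodule.smul_mem_iff _ h0).1 hc)

variable [Module.Finite k L]

theorem exists_sub_smul_mem (h : IsWittAdapted n F e) {i : ℕ} (h1 : 1 ≤ i) {x : L}
    (hx : x ∈ F i) : ∃ c : k, x - c • e i ∈ F (i + 1) := by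
  rcases Nat.lt_or_ge n i with hi | hi
  · refine ⟨0, ?_⟩
    rw [h.flag.eq_zero hi hx]
    simp
  · exact h.flag.exists_sub_smul_mem h1 (h.mem i h1) (h.notMem i h1 hi) hx

theorem mem_span (h : IsWittAdapted n F e) (d : ℕ) : ∀ i, 1 ≤ i → n + 1 ≤ i + d → ∀ x ∈ F i,
    x ∈ Submodule.span k (Set.range fun j : Fin n => e (j + 1)) := by
  induction d with
  | zero =>
    intro i _ hi x hx
    rw [h.flag.eq_zero (by omega) hx]
    exact zero_mem _
  | succ d ih =>
    intro i h1 hi x hx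
    rcases Nat.lt_or_ge n i with hi' | hi'
    · rw [h.flag.eq_zero hi' hx]
      exact zero_mem _
    obtain ⟨c, hc⟩ := h.exists_sub_smul_mem h1 hx
    have h2 := ih (i + 1) (by omega) (by omega) _ hc
    have h3 : e i ∈ Submodule.span k (Set.range fun j : Fin n => e (j + 1)) :=
      Submodule.subset_span ⟨⟨i - 1, by omega⟩, by simp [Nat.sub_add_cancel h1]⟩
    simpa using add_mem h2 (Submodule.smul_mem _ c h3)

theorem eq_zero (h : IsWittAdapted n F e) {i : ℕ} (hi : n < i) : e i = 0 :=
  h.flag.eq_zero hi (h.mem i (by omega))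

/-- The basis of `L` given by an adapted sequence. -/
theorem exists_basis (h : IsWittAdapted n F e) :
    ∃ b : Module.Basis (Fin n) k L, ∀ j : Fin n, b j = e (j + 1) := by
  have hn : Module.finrank k L = n := by
    rw [← finrank_top, ← h.flag.top, h.flag.finrank 1 le_rfl]; omega
  have hs : ⊤ ≤ Submodule.span k (Set.range fun j : Fin n => e (j + 1)) :=
    fun x _ => h.mem_span n 1 le_rfl (by omega) x (h.flag.mem_one x)
  refine ⟨basisOfTopLeSpanOfCardEqFinrank (fun j : Fin n => e (j + 1)) hs (by simp [hn]), ?_⟩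
  intro j
  simp

/-- An algebra with a homogeneous adapted basis has a non-singular derivation. -/
theorem hasNonsingularDerivation [CharZero k] (h : IsWittAdapted n F e)
    (hb : ∀ i j, 1 ≤ i → 1 ≤ j → ⁅e i, e j⁆ = ((j : k) - i) • e (i + j)) :
    HasNonsingularDerivation k L := by
  obtain ⟨b, hbe⟩ := h.exists_basis
  let D : L →ₗ[k] L := b.constr k fun j : Fin n => ((j : ℕ) + 1 : k) • b j
  have hD : ∀ i, 1 ≤ i → D (e i) = (i : k) • e i := by
    intro i h1
    rcases Nat.lt_or_ge n i with hi | hi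
    · rw [h.eq_zero hi]; simp
    have h2 := b.constr_basis k (fun j : Fin n => ((j : ℕ) + 1 : k) • b j) ⟨i - 1, by omega⟩
    rw [hbe] at h2
    simp only [Nat.sub_add_cancel h1] at h2
    rw [show D (e i) = _ from h2]
    congr 1
    exact_mod_cast Nat.sub_add_cancel h1
  have hleib : ∀ x y : L, D ⁅x, y⁆ = ⁅x, D y⁆ - ⁅y, D x⁆ := by
    let A : L →ₗ[k] L →ₗ[k] L := (LieModule.toEnd k L L : L →ₗ[k] Module.End k L).compr₂ D
    let B : L →ₗ[k] L →ₗ[k] L :=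
      (LieModule.toEnd k L L : L →ₗ[k] Module.End k L).compl₂ D +
        (LieModule.toEnd k L L : L →ₗ[k] Module.End k L).comp D
    have hAB : A = B := by
      refine LinearMap.ext_basis b b fun i j => ?_
      simp only [A, B, LinearMap.compr₂_apply, LinearMap.add_apply, LinearMap.compl₂_apply,
        LinearMap.comp_apply, LieHom.coe_toLinearMap, LieModule.toEnd_apply_apply, hbe]
      rw [hD _ (by omega), hD _ (by omega), hb _ _ (by omega) (by omega), map_smul,
        hD _ (by omega), lie_smul, smul_lie, hb _ _ (by omega) (by omega), smul_smul, smul_smul,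
        smul_smul, ← add_smul]
      congr 1
      push_cast
      ring
    intro x y
    have h2 := LinearMap.congr_fun (LinearMap.congr_fun hAB x) y
    simp only [A, B, LinearMap.compr₂_apply, LinearMap.add_apply, LinearMap.compl₂_apply,
      LinearMap.comp_apply, LieHom.coe_toLinearMap, LieModule.toEnd_apply_apply] at h2
    rw [h2, ← lie_skew y (D x), sub_neg_eq_add]
  refine ⟨⟨D, hleib⟩, ?_⟩
  have hsurj : Function.Surjective D := by
    rw [← LinearMap.range_eq_top, eq_top_iff, ← b.span_eq, Submodule.span_le]
    rintro _ ⟨j, rfl⟩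
    refine ⟨((j : ℕ) + 1 : k)⁻¹ • b j, ?_⟩
    have hne : ((j : ℕ) + 1 : k) ≠ 0 := Nat.cast_add_one_ne_zero _
    rw [map_smul, hbe, hD _ (by omega), smul_smul]
    push_cast
    rw [inv_mul_cancel₀ hne, one_smul]
  exact ⟨LinearMap.injective_iff_surjective.2 hsurj, hsurj⟩

end IsWittAdapted

end Flag

end Filiform

/-! ### From homogeneous triple brackets to homogeneous brackets, in dimension `m + 5`. -/

namespace Filiform

section Homogeneous

variable {k : Type*} {L : Type*} [Field k] [CharZero k] [LieRing L] [LieAlgebra k L]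
  [Module.Finite k L] {m : ℕ} {F : ℕ → Submodule k L} {f : ℕ → L}

namespace IsWittAdapted

/-- The error is killed by `ad (f 3)`, because the triple bracket `[f 3, [f 1, f 2]]` has
coefficient `3 - 3 = 0`. On a leading term of degree `j ≥ 4` the map `ad (f 3)` acts by `j - 3 ≠ 0`,
visibly so while `j + 3 ≤ m + 5`. Hence no leading term of degree at most `m + 2` survives. -/
theorem lie_sub_mem (h : IsWittAdapted (m + 5) F f) (hm : 4 ≤ m)
    (ht : ∀ i j l, 1 ≤ i → 1 ≤ j → 1 ≤ l →
      ⁅f i, ⁅f j, f l⁆⁆ = (((l : k) - j) * ((j + l : ℕ) - (i : k))) • f (i + (j + l))) :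
    ⁅f 1, f 2⁆ - f 3 ∈ F (m + 3) := by
  have h3 : ⁅f 3, ⁅f 1, f 2⁆ - f 3⁆ = 0 := by
    rw [lie_sub, ht 3 1 2 (by norm_num) le_rfl (by norm_num), lie_self, sub_zero]
    norm_num
  have key : ∀ d, d + 4 ≤ m + 3 → ⁅f 1, f 2⁆ - f 3 ∈ F (d + 4) := by
    intro d
    induction d with
    | zero =>
      intro _
      have := h.bracket 1 2 le_rfl (by norm_num)
      norm_num at this
      exact this
    | succ d ih =>
      intro hd
      have h4 := ih (by omega)
      obtain ⟨c, hc⟩ := h.exists_sub_smul_mem (by omega) h4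
      have h5 := h.lie (by norm_num) (by omega) (h.mem 3 (by norm_num)) hc
      rw [lie_sub, h3, lie_smul] at h5
      have h6 := (F (3 + (d + 4) + 1)).smul_mem c (h.bracket 3 (d + 4) (by norm_num) (by omega))
      have h7 := neg_mem (add_mem h5 h6)
      have h8 : (c * ((d + 4 : ℕ) - (3 : k))) • f (3 + (d + 4)) ∈ F (3 + (d + 4) + 1) := by
        convert h7 using 1
        · rfl
        · rw [Nat.cast_ofNat]
          module
      have h9 := h.eq_zero_of_smul_mem (by omega) (by omega) h8
      have h10 : ((d + 4 : ℕ) - (3 : k)) ≠ 0 := by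
        rw [sub_ne_zero]
        exact_mod_cast (by omega : d + 4 ≠ 3)
      rw [(mul_eq_zero.1 h9).resolve_right h10, zero_smul, sub_zero] at hc
      exact hc
  have := key (m - 1) (by omega)
  rwa [show m - 1 + 4 = m + 3 by omega] at this

-- Both sides evaluate `[f 1, [f 1, [f 1, f 2]]]`: once with the inner triple bracket replaced by `2
-- f 4`, once with `[f 1, f 2]` split into `f 3` and its error.
omit [CharZero k] [Module.Finite k L] in
theorem two_smul_lie_one_four
    (ht : ∀ i j l, 1 ≤ i → 1 ≤ j → 1 ≤ l →
      ⁅f i, ⁅f j, f l⁆⁆ = (((l : k) - j) * ((j + l : ℕ) - (i : k))) • f (i + (j + l))) :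
    (2 : k) • ⁅f 1, f 4⁆ = (6 : k) • f 5 + ⁅f 1, ⁅f 1, ⁅f 1, f 2⁆ - f 3⁆⁆ := by
  have h1 := ht 1 1 2 le_rfl le_rfl (by norm_num)
  have h2 := ht 1 1 3 le_rfl le_rfl (by norm_num)
  norm_num at h1 h2
  rw [lie_sub, lie_sub, h1, h2, lie_smul]
  module

/-- If `[f 1, f j]` is homogeneous modulo `F (m + 4)`, applying `ad (f i) ∘ ad (f 1)` kills the
error, and `[f i, f (j + 2)]` becomes a multiple of the triple bracket `[f i, [f 1, f (1 + j)]]`.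
Each step advances by two, so both `j = 3` and `j = 4` serve as starting points. -/
theorem lie_eq_of_five_le (h : IsWittAdapted (m + 5) F f) (hm : 4 ≤ m)
    (ht : ∀ i j l, 1 ≤ i → 1 ≤ j → 1 ≤ l →
      ⁅f i, ⁅f j, f l⁆⁆ = (((l : k) - j) * ((j + l : ℕ) - (i : k))) • f (i + (j + l))) :
    ∀ i j, 1 ≤ i → 5 ≤ j → ⁅f i, f j⁆ = ((j : k) - i) • f (i + j) := by
  have hv := h.lie_sub_mem hm ht
  have step : ∀ j, 3 ≤ j → ⁅f 1, f j⁆ - ((j : k) - 1) • f (1 + j) ∈ F (m + 4) →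
      ∀ i, 1 ≤ i → ⁅f i, f (j + 2)⁆ = (((j + 2 : ℕ) : k) - i) • f (i + (j + 2)) := by
    intro j hj hA i hi
    have h1 : ⁅f i, ⁅f 1, ⁅f 1, f j⁆ - ((j : k) - 1) • f (1 + j)⁆⁆ = 0 :=
      h.flag.eq_zero (by omega) (h.lie hi (by omega) (h.mem i hi)
        (h.lie le_rfl (by omega) (h.mem 1 le_rfl) hA))
    have h2 := ht 1 1 j le_rfl le_rfl (by omega)
    have h3 := ht i 1 (1 + j) hi le_rfl (by omega)
    rw [lie_sub, lie_sub, h2, lie_smul, lie_smul, lie_smul, h3, smul_smul] at h1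
    have hc : ((j : k) - 1) * j ≠ 0 := by
      refine mul_ne_zero ?_ ?_
      · rw [sub_ne_zero]; exact_mod_cast (by omega : j ≠ 1)
      · exact_mod_cast (by omega : j ≠ 0)
    rw [show j + 2 = 1 + (1 + j) by omega]
    refine smul_right_injective L hc ?_
    simp only
    rw [smul_smul]
    rw [sub_eq_zero] at h1
    push_cast at h1 ⊢
    convert h1 using 2 <;> ring
  have hA : ∀ d, ⁅f 1, f (d + 3)⁆ - (((d + 3 : ℕ) : k) - 1) • f (1 + (d + 3)) ∈ F (m + 4) ∧
      ⁅f 1, f (d + 4)⁆ - (((d + 4 : ℕ) : k) - 1) • f (1 + (d + 4)) ∈ F (m + 4) := by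
    intro d
    induction d with
    | zero =>
      constructor
      · have h1 := ht 1 1 2 le_rfl le_rfl (by norm_num)
        norm_num at h1
        have h2 := neg_mem (h.lie le_rfl (by omega) (h.mem 1 le_rfl) hv)
        rw [lie_sub, h1, neg_sub] at h2
        norm_num
        rwa [add_comm 1 (m + 3)] at h2
      · have h1 := two_smul_lie_one_four ht
        have h2 := h.flag.mem_of_le (i := m + 4) (by omega)
          (h.lie le_rfl (by omega) (h.mem 1 le_rfl)
            (h.lie le_rfl (by omega) (h.mem 1 le_rfl) hv))
        have h3 := (F (m + 4)).smul_mem (2⁻¹ : k) h2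
        convert h3 using 1
        rw [← sub_eq_iff_eq_add'.2 h1, smul_sub, smul_smul, smul_smul]
        norm_num
    | succ d ih =>
      refine ⟨ih.2, ?_⟩
      have := step (d + 3) (by omega) (by simpa using ih.1) 1 le_rfl
      rw [show d + 1 + 4 = d + 3 + 2 by omega, this]
      simp
  intro i j hi hj
  obtain ⟨d, rfl⟩ := Nat.exists_eq_add_of_le hj
  have := step (d + 3) (by omega) (by simpa using (hA d).1) i hi
  rwa [show d + 3 + 2 = 5 + d by omega] at this

/-- Here `2 f 4 = [f 1, [f 1, f 2]]`, and the error of `[f 1, f 2]` contributes to `F (m + 4 + i)`.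
This is zero for `i ≥ 2`, whereas for `i = 1` a term in degree `m + 5` can remain. -/
theorem lie_eq_of_four (h : IsWittAdapted (m + 5) F f) (hm : 4 ≤ m)
    (ht : ∀ i j l, 1 ≤ i → 1 ≤ j → 1 ≤ l →
      ⁅f i, ⁅f j, f l⁆⁆ = (((l : k) - j) * ((j + l : ℕ) - (i : k))) • f (i + (j + l)))
    {i : ℕ} (hi : 2 ≤ i) : ⁅f i, f 4⁆ = ((4 : k) - i) • f (i + 4) := by
  have hv := h.lie_sub_mem hm ht
  have h1 := ht 1 1 2 le_rfl le_rfl (by norm_num)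
  norm_num at h1
  have h2 : ⁅f i, ⁅f 1, ⁅f 1, f 2⁆ - f 3⁆⁆ = 0 :=
    h.flag.eq_zero (by omega) (h.lie (by omega) (by omega) (h.mem i (by omega))
        (h.lie le_rfl (by omega) (h.mem 1 le_rfl) hv))
  rw [lie_sub, lie_sub, h1, ht i 1 3 (by omega) le_rfl (by norm_num), lie_smul, sub_eq_zero] at h2
  refine smul_right_injective L (two_ne_zero : (2 : k) ≠ 0) ?_
  simp only
  rw [h2, smul_smul]
  norm_num

/-- Homogeneity of all triple brackets suffices for the existence of a non-singular derivation. -/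
theorem hasNonsingularDerivation_of_triple (h : IsWittAdapted (m + 5) F f) (hm : 4 ≤ m)
    (ht : ∀ i j l, 1 ≤ i → 1 ≤ j → 1 ≤ l →
      ⁅f i, ⁅f j, f l⁆⁆ = (((l : k) - j) * ((j + l : ℕ) - (i : k))) • f (i + (j + l))) :
    HasNonsingularDerivation k L := by
  have hv := h.lie_sub_mem hm ht
  have h5 := h.lie_eq_of_five_le hm ht
  obtain ⟨w, hw⟩ := h.exists_sub_smul_mem (by omega) hv
  set v : L := ⁅f 1, f 2⁆ - f 3 with hvdef
  have hlie12 : ⁅f 1, f 2⁆ = f 3 + v := by rw [hvdef]; abel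
  -- Once `f 2` is changed by `y • f (m + 2)` and the next three vectors are redefined through `ad
  -- (f 1)`, the only condition left is `[h2, h3] = h5'`. It is linear in `y` in degree `m + 5`, and
  -- this is its solution.
  set y : k := -(w * (m + 2) * (m + 3)) / ((m - 1) * (m ^ 2 + m + 6)) with hy
  have hm1 : (m : k) - 1 ≠ 0 := by
    rw [sub_ne_zero]; exact_mod_cast (by omega : m ≠ 1)
  have hm2 : (m : k) ^ 2 + m + 6 ≠ 0 := by exact_mod_cast (by omega : m ^ 2 + m + 6 ≠ 0)
  have hyw : y * ((m - 1) * (m ^ 2 + m + 6)) = -(w * (m + 2) * (m + 3)) := by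
    rw [hy, div_mul_cancel₀ _ (mul_ne_zero hm1 hm2)]
  -- the corrections of the basis vectors
  let h2 : L := f 2 + y • f (m + 2)
  let h3 : L := ⁅f 1, h2⁆
  let h4 : L := (2⁻¹ : k) • ⁅f 1, h3⁆
  let h5' : L := (3⁻¹ : k) • ⁅f 1, h4⁆
  let g : ℕ → L := fun i =>
    if i = 2 then h2 else if i = 3 then h3 else if i = 4 then h4 else if i = 5 then h5' else f i
  have g1 : g 1 = f 1 := by simp [g]
  have g2 : g 2 = h2 := by simp [g]
  have g3 : g 3 = h3 := by simp [g]
  have g4 : g 4 = h4 := by simp [g]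
  have g5 : g 5 = h5' := by simp [g]
  have hg : ∀ i, 6 ≤ i → g i = f i := by
    intro i hi
    simp [g, show i ≠ 2 by omega, show i ≠ 3 by omega, show i ≠ 4 by omega, show i ≠ 5 by omega]
  have e3 : h3 = f 3 + v + (y * (m + 1)) • f (m + 3) := by
    simp only [h3, h2]
    rw [lie_add, lie_smul, h5 1 (m + 2) le_rfl (by omega), hlie12, smul_smul,
      show 1 + (m + 2) = m + 3 by omega]
    push_cast
    congr 3
    ring
  have t112 : ⁅f 1, f 3 + v⁆ = (2 : k) • f 4 := by
    rw [← hlie12, ht 1 1 2 le_rfl le_rfl (by norm_num)]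
    norm_num
  have e4 : h4 = f 4 + (2⁻¹ * (y * (m + 1) * (m + 2))) • f (m + 4) := by
    simp only [h4]
    rw [e3, lie_add, t112, lie_smul, h5 1 (m + 3) le_rfl (by omega), smul_add, smul_smul,
      smul_smul, smul_smul, show 1 + (m + 3) = m + 4 by omega]
    norm_num
    congr 1
    ring
  have hvv : ⁅f 1, ⁅f 1, v⁆⁆ = (w * ((m + 2) * (m + 3))) • f (m + 5) := by
    have h6 : ⁅f 1, ⁅f 1, v - w • f (m + 3)⁆⁆ = 0 :=
      h.flag.eq_zero (by omega) (h.lie le_rfl (by omega) (h.mem 1 le_rfl)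
        (h.lie le_rfl (by omega) (h.mem 1 le_rfl) hw))
    rw [lie_sub, lie_sub, sub_eq_zero] at h6
    rw [h6, lie_smul, lie_smul, h5 1 (m + 3) le_rfl (by omega), lie_smul,
      show 1 + (m + 3) = m + 4 by omega, h5 1 (m + 4) le_rfl (by omega), smul_smul, smul_smul,
      show 1 + (m + 4) = m + 5 by omega]
    push_cast
    congr 1
    ring
  have e14 : ⁅f 1, f 4⁆ = (3 : k) • f 5 + (2⁻¹ * (w * ((m + 2) * (m + 3)))) • f (m + 5) := by
    have h6 := two_smul_lie_one_four ht
    rw [← hvdef, hvv] at h6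
    refine smul_right_injective L (two_ne_zero : (2 : k) ≠ 0) ?_
    simp only
    rw [h6]
    module
  have e5 : h5' = f 5 + (6⁻¹ * (w * ((m + 2) * (m + 3)) + y * (m + 1) * (m + 2) * (m + 3))) •
      f (m + 5) := by
    simp only [h5']
    rw [e4, lie_add, e14, lie_smul, h5 1 (m + 4) le_rfl (by omega),
      show 1 + (m + 4) = m + 5 by omega]
    push_cast
    module
  have hdiff : ∀ i, 1 ≤ i → g i - f i ∈ F (m + i) := by
    intro i hi
    rcases Nat.lt_or_ge i 6 with hi' | hi'
    · interval_cases i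
      · rw [g1, sub_self]; exact zero_mem _
      · rw [g2]
        simp only [h2, add_sub_cancel_left]
        exact (F _).smul_mem _ (h.mem _ (by omega))
      · rw [g3, e3, add_assoc, add_sub_cancel_left]
        exact add_mem hv ((F _).smul_mem _ (h.mem _ (by omega)))
      · rw [g4, e4, add_sub_cancel_left]
        exact (F _).smul_mem _ (h.mem _ (by omega))
      · rw [g5, e5, add_sub_cancel_left]
        exact (F _).smul_mem _ (h.mem _ (by omega))
    · rw [hg i hi', sub_self]; exact zero_mem _
  have hmem : ∀ i, 1 ≤ i → g i ∈ F i := by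
    intro i hi
    have := add_mem (h.flag.mem_of_le (by omega) (hdiff i hi)) (h.mem i hi)
    simpa using this
  -- brackets of total degree at least six are homogeneous
  have hbig : ∀ i j, 1 ≤ i → i < j → 6 ≤ i + j → ⁅g i, g j⁆ = ((j : k) - i) • g (i + j) := by
    intro i j hi hij h6
    -- The corrections raise degree by `m`, so they enter the bracket only in `F (m + i + j)`, which
    -- vanishes for `i + j ≥ 6`.
    have hz : ⁅g i, g j⁆ = ⁅f i, f j⁆ := by
      have z1 : ⁅g i - f i, g j⁆ = 0 :=
        h.flag.eq_zero (by omega) (h.lie (by omega) (by omega) (hdiff i hi) (hmem j (by omega)))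
      have z2 : ⁅f i, g j - f j⁆ = 0 :=
        h.flag.eq_zero (by omega) (h.lie (by omega) (by omega) (h.mem i hi) (hdiff j (by omega)))
      rw [sub_lie, sub_eq_zero] at z1
      rw [lie_sub, sub_eq_zero] at z2
      rw [z1, z2]
    rw [hz, hg (i + j) h6]
    rcases Nat.lt_or_ge j 5 with h7 | h7
    · obtain rfl : j = 4 := by omega
      exact_mod_cast h.lie_eq_of_four hm ht (by omega : 2 ≤ i)
    · exact h5 i j hi h7
  have h23 : ⁅h2, h3⁆ = h5' := by
    have z1 : ⁅f (m + 2), v⁆ = 0 :=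
      h.flag.eq_zero (by omega) (h.lie (by omega) (by omega) (h.mem _ (by omega)) hv)
    have z2 : ⁅f (m + 2), f (m + 3)⁆ = 0 :=
      h.flag.eq_zero (by omega) (h.lie (by omega) (by omega) (h.mem _ (by omega))
        (h.mem _ (by omega)))
    have z3 : ⁅f 2, f 3 + v⁆ = f 5 := by
      rw [← hlie12, ht 2 1 2 (by norm_num) le_rfl (by norm_num)]
      norm_num
    have z4 : ⁅f (m + 2), f 3⁆ = (-((m : k) - 1)) • f (m + 5) := by
      rw [← lie_skew, h5 3 (m + 2) (by norm_num) (by omega), ← neg_smul,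
        show 3 + (m + 2) = m + 5 by omega]
      push_cast
      congr 1
      ring
    rw [e5, e3]
    simp only [h2]
    rw [add_lie, lie_add, z3, smul_lie, lie_add, lie_add, z1, z4, lie_smul, lie_smul, z2,
      h5 2 (m + 3) (by norm_num) (by omega), show 2 + (m + 3) = m + 5 by omega]
    have hc : y * ((m : k) + 1) * (m + 1) + y * (-(m - 1)) =
        6⁻¹ * (w * ((m + 2) * (m + 3)) + y * (m + 1) * (m + 2) * (m + 3)) := by
      have h6 : (6 : k) ≠ 0 := by norm_num
      field_simp
      linear_combination -hyw
    rw [← hc]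
    push_cast
    module
  have hlt : ∀ i j, 1 ≤ i → i < j → ⁅g i, g j⁆ = ((j : k) - i) • g (i + j) := by
    intro i j hi hij
    rcases Nat.lt_or_ge (i + j) 6 with h6 | h6
    · have : (i = 1 ∧ j = 2) ∨ (i = 1 ∧ j = 3) ∨ (i = 1 ∧ j = 4) ∨ (i = 2 ∧ j = 3) := by omega
      rcases this with ⟨rfl, rfl⟩ | ⟨rfl, rfl⟩ | ⟨rfl, rfl⟩ | ⟨rfl, rfl⟩
      · norm_num [g1, g2, g3, h3]
      · rw [g1, g3, g4]
        simp only [h4]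
        rw [smul_smul]
        norm_num
      · rw [g1, g4, g5]
        simp only [h5']
        rw [smul_smul]
        norm_num
      · norm_num [g2, g3, g5, h23]
    · exact hbig i j hi hij h6
  have hall : ∀ i j, 1 ≤ i → 1 ≤ j → ⁅g i, g j⁆ = ((j : k) - i) • g (i + j) := by
    intro i j hi hj
    rcases lt_trichotomy i j with h6 | rfl | h6
    · exact hlt i j hi h6
    · simp
    · rw [← lie_skew, hlt j i hj h6, ← neg_smul, neg_sub, add_comm]
  refine IsWittAdapted.hasNonsingularDerivation (n := m + 5) (F := F) (e := g)
    ⟨h.flag, h.lie, hmem, fun i hi hi' hgi => ?_, fun i j hi hj => ?_⟩ hall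
  · refine h.notMem i hi hi' ?_
    have := sub_mem hgi (h.flag.mem_of_le (by omega) (hdiff i hi))
    simpa using this
  · rw [hall i j hi hj, sub_self]
    exact zero_mem _

end IsWittAdapted

end Homogeneous

end Filiform

/-! ### Prederivations of algebras of Witt type. -/

namespace Filiform

section Prederivation

variable {k : Type*} {L : Type*} [Field k] [LieRing L] [LieAlgebra k L]
  {n : ℕ} {F : ℕ → Submodule k L} {e : ℕ → L} {P : L →ₗ[k] L}

namespace IsWittAdapted

/-- Weights add up along triple brackets, modulo higher filtration. -/
theorem prederivation_sub_mem (h : IsWittAdapted n F e) (hP : IsPrederivation P) {i j l : ℕ}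
    (hi : 1 ≤ i) (hj : 1 ≤ j) (hl : 1 ≤ l) {x y z : L} (hx : x ∈ F i) (hy : y ∈ F j)
    (hz : z ∈ F l) {α β γ : k} (hPx : P x - α • x ∈ F (i + 1)) (hPy : P y - β • y ∈ F (j + 1))
    (hPz : P z - γ • z ∈ F (l + 1)) :
    P ⁅x, ⁅y, z⁆⁆ - (α + β + γ) • ⁅x, ⁅y, z⁆⁆ ∈ F (i + j + l + 1) := by
  have h1 := h.lie (by omega) (by omega) hPx (h.lie hj hl hy hz)
  have h2 := h.lie hi (by omega) hx (h.lie (by omega) hl hPy hz)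
  have h3 := h.lie hi (by omega) hx (h.lie hj (by omega) hy hPz)
  rw [show i + 1 + (j + l) = i + j + l + 1 by omega] at h1
  rw [show i + (j + 1 + l) = i + j + l + 1 by omega] at h2
  rw [show i + (j + (l + 1)) = i + j + l + 1 by omega] at h3
  convert add_mem (add_mem h1 h2) h3 using 1
  rw [hP]
  simp only [sub_lie, lie_sub, smul_lie, lie_smul]
  module

theorem eq_of_sub_smul_mem (h : IsWittAdapted n F e) {i : ℕ} (h1 : 1 ≤ i) (hi : i ≤ n) {x : L}
    {c d : k} (hc : x - c • e i ∈ F (i + 1)) (hd : x - d • e i ∈ F (i + 1)) : c = d := by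
  rw [← sub_eq_zero]
  refine h.eq_zero_of_smul_mem h1 hi ?_
  have := sub_mem hd hc
  rw [sub_sub_sub_cancel_left, ← sub_smul] at this
  exact this

variable [Module.Finite k L]

theorem map_mem_of_forall (h : IsWittAdapted n F e) (P : L →ₗ[k] L) {S : Submodule k L} {i : ℕ}
    (hi : 1 ≤ i) (hS : ∀ j, i ≤ j → P (e j) ∈ S) {x : L} (hx : x ∈ F i) : P x ∈ S := by
  have key : ∀ d j, i ≤ j → n + 1 ≤ j + d → ∀ x ∈ F j, P x ∈ S := by
    intro d
    induction d with
    | zero =>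
      intro j _ hj x hx
      rw [h.flag.eq_zero (by omega) hx, map_zero]
      exact zero_mem _
    | succ d ih =>
      intro j hij hj x hx
      obtain ⟨c, hc⟩ := h.exists_sub_smul_mem (by omega) hx
      have h1 := add_mem (ih (j + 1) (by omega) (by omega) _ hc) (S.smul_mem c (hS j hij))
      simpa using h1
  exact key (n + 1) i le_rfl (by omega) x hx

theorem lie_one_mem (h : IsWittAdapted n F e) (x : L) : ⁅e 1, x⁆ ∈ F 3 := by
  obtain ⟨c, hc⟩ := h.exists_sub_smul_mem le_rfl (h.flag.mem_one x)
  have := h.lie le_rfl (by norm_num) (h.mem 1 le_rfl) hc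
  simpa using this

variable [CharZero k]

-- The prederivation identity sees only triple brackets, so it propagates `P` along `e j ↦ e (j +
-- 2)`. The parities stay separate and must later be linked through `[e 2, e 3]`.
omit [Module.Finite k L] in
theorem smul_map_add_two (hP : IsPrederivation P)
    (he : ∀ i, 2 ≤ i → ⁅e 1, e i⁆ = ((i : k) - 1) • e (i + 1)) {j : ℕ} (hj : 2 ≤ j) :
    ((j : k) - 1) * j ≠ 0 ∧ (((j : k) - 1) * j) • e (j + 2) = ⁅e 1, ⁅e 1, e j⁆⁆ ∧
    (((j : k) - 1) * j) • P (e (j + 2)) =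
      ⁅P (e 1), ⁅e 1, e j⁆⁆ + ⁅e 1, ⁅P (e 1), e j⁆⁆ + ⁅e 1, ⁅e 1, P (e j)⁆⁆ := by
  have h1 : (((j : k) - 1) * j) • e (j + 2) = ⁅e 1, ⁅e 1, e j⁆⁆ := by
    rw [he j hj, lie_smul, he (j + 1) (by omega), smul_smul]
    push_cast
    congr 2
    ring
  refine ⟨mul_ne_zero ?_ ?_, h1, ?_⟩
  · rw [sub_ne_zero]; exact_mod_cast (by omega : j ≠ 1)
  · exact_mod_cast (by omega : j ≠ 0)
  · rw [← hP, ← h1, map_smul]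

/-- A prederivation maps `e 2` and `e 3` into the right filtration steps. -/
theorem prederivation_two_three_mem (h : IsWittAdapted n F e) (hn : 6 ≤ n)
    (he : ∀ i, 2 ≤ i → ⁅e 1, e i⁆ = ((i : k) - 1) • e (i + 1)) (hP : IsPrederivation P) :
    P (e 2) ∈ F 2 ∧ P (e 3) ∈ F 3 := by
  have hmem1 := h.mem 1 le_rfl
  have hmem2 := h.mem 2 (by norm_num)
  have hmem3 := h.mem 3 (by norm_num)
  have e12 : ⁅e 1, e 2⁆ = e 3 := by simpa [show (2 : k) - 1 = 1 by norm_num] using he 2 le_rfl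
  have e13 : ⁅e 1, e 3⁆ = (2 : k) • e 4 := by
    simpa [show (3 : k) - 1 = 2 by norm_num] using he 3 (by norm_num)
  have e14 : ⁅e 1, e 4⁆ = (3 : k) • e 5 := by
    simpa [show (4 : k) - 1 = 3 by norm_num] using he 4 (by norm_num)
  -- Bootstrapping: without any knowledge of `P (e j)`, the operator `ad (e 1)` applied twice lands
  -- in `F 4`; feeding this back once more gives `F 6`.
  have h4 : ∀ j, 4 ≤ j → P (e j) ∈ F 4 := by
    intro j hj
    obtain ⟨j, rfl⟩ : ∃ i, j = i + 2 := ⟨j - 2, by omega⟩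
    obtain ⟨h0, -, h1⟩ := smul_map_add_two hP he (by omega : 2 ≤ j)
    rw [← Submodule.smul_mem_iff _ h0, h1]
    have hPe := h.flag.mem_one (P (e 1))
    have hej := h.mem j (by omega)
    refine add_mem (add_mem ?_ ?_) ?_
    · exact h.flag.mem_of_le (by omega)
        (h.lie le_rfl (by omega) hPe (h.lie le_rfl (by omega) hmem1 hej))
    · exact h.flag.mem_of_le (by omega)
        (h.lie le_rfl (by omega) hmem1 (h.lie le_rfl (by omega) hPe hej))
    · exact h.lie le_rfl (by omega) hmem1 (h.lie_one_mem _)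
  have h6 : ∀ j, 6 ≤ j → P (e j) ∈ F 6 := by
    intro j hj
    obtain ⟨j, rfl⟩ : ∃ i, j = i + 2 := ⟨j - 2, by omega⟩
    obtain ⟨h0, -, h1⟩ := smul_map_add_two hP he (by omega : 2 ≤ j)
    rw [← Submodule.smul_mem_iff _ h0, h1]
    have hPe := h.flag.mem_one (P (e 1))
    have hej := h.mem j (by omega)
    refine add_mem (add_mem ?_ ?_) ?_
    · exact h.flag.mem_of_le (by omega)
        (h.lie le_rfl (by omega) hPe (h.lie le_rfl (by omega) hmem1 hej))
    · exact h.flag.mem_of_le (by omega)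
        (h.lie le_rfl (by omega) hmem1 (h.lie le_rfl (by omega) hPe hej))
    · exact h.lie le_rfl (by omega) hmem1 (h.lie le_rfl (by omega) hmem1 (h4 j (by omega)))
  have hF6 : ∀ x ∈ F 6, P x ∈ F 6 := fun x hx => h.map_mem_of_forall P (by norm_num) h6 hx
  obtain ⟨b, hb⟩ := h.exists_sub_smul_mem le_rfl (h.flag.mem_one (P (e 2)))
  obtain ⟨c, hc⟩ := h.exists_sub_smul_mem le_rfl (h.flag.mem_one (P (e 3)))
  obtain ⟨c', hc'⟩ := h.exists_sub_smul_mem (by norm_num) hc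
  -- apply `P` to `[e 1, [e 2, e 3]]`, an element of `F 6`
  have h23 : ⁅e 2, e 3⁆ ∈ F 5 := h.lie (by norm_num) (by norm_num) hmem2 hmem3
  have k1 := hF6 _ (h.lie le_rfl (by norm_num) hmem1 h23)
  rw [hP] at k1
  have k2 : ⁅P (e 1), ⁅e 2, e 3⁆⁆ ∈ F 6 := h.lie le_rfl (by norm_num) (h.flag.mem_one _) h23
  have k3 : ⁅e 1, ⁅P (e 2) - b • e 1, e 3⁆⁆ ∈ F 6 :=
    h.lie le_rfl (by norm_num) hmem1 (h.lie (by norm_num) (by norm_num) hb hmem3)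
  have k4 : ⁅e 1, ⁅e 2, P (e 3) - c • e 1 - c' • e 2⁆⁆ ∈ F 6 :=
    h.lie le_rfl (by norm_num) hmem1 (h.lie (by norm_num) (by norm_num) hmem2 hc')
  -- Modulo `F 6` only the unwanted `e 1`-components `b` of `P (e 2)` and `c` of `P (e 3)` survive,
  -- in different degrees, so both must vanish.
  have k5 : (6 * b) • e 5 - (2 * c) • e 4 ∈ F 6 := by
    convert sub_mem (sub_mem (sub_mem k1 k2) k3) k4 using 1
    simp only [sub_lie, lie_sub, smul_lie, lie_smul, lie_self, smul_zero, sub_zero]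
    rw [← lie_skew (e 2) (e 1), e12, lie_neg, e13, lie_smul, e14]
    module
  have hc0 : c = 0 := by
    have k6 : (2 * c) • e 4 ∈ F 5 := by
      have := sub_mem ((F 5).smul_mem (6 * b) (h.mem 5 (by norm_num)))
        (h.flag.mem_of_le (by norm_num : 5 ≤ 6) k5)
      simpa using this
    simpa using h.eq_zero_of_smul_mem (by norm_num) (by omega) k6
  have hb0 : b = 0 := by
    rw [hc0, mul_zero, zero_smul, sub_zero] at k5
    simpa using h.eq_zero_of_smul_mem (by norm_num) (by omega) k5
  rw [hb0, zero_smul, sub_zero] at hb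
  rw [hc0, zero_smul, sub_zero] at hc'
  -- compare `P (e 5)` computed from `[e 2, [e 1, e 2]]` and from `[e 1, [e 1, e 3]]`
  have l1 : P ⁅e 2, ⁅e 1, e 2⁆⁆ ∈ F 5 := by
    rw [hP]
    refine add_mem (add_mem ?_ ?_) ?_
    · rw [e12]
      exact h.lie (by norm_num) (by norm_num) hb hmem3
    · exact h.lie (by norm_num) (by norm_num) hmem2
        (h.lie le_rfl (by norm_num) (h.flag.mem_one _) hmem2)
    · exact h.lie (by norm_num) (by norm_num) hmem2 (h.lie_one_mem _)
  -- Modulo `F 6`, which `P` preserves, `e 5` is `[e 2, [e 1, e 2]]`.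
  have l2 : P (e 5) ∈ F 5 := by
    have l3 := hF6 _ (h.bracket 2 3 (by norm_num) (by norm_num))
    norm_num at l3
    rw [← e12] at l3
    have := sub_mem l1 (h.flag.mem_of_le (by norm_num : 5 ≤ 6) l3)
    simp only [sub_sub_cancel] at this
    have l4 : ((3 : k) - 2) = 1 := by norm_num
    simpa [l4] using this
  obtain ⟨-, -, l5⟩ := smul_map_add_two hP he (by norm_num : 2 ≤ 3)
  have l6 : ⁅e 1, ⁅e 1, P (e 3) - c' • e 2⁆⁆ ∈ F 5 :=
    h.lie le_rfl (by norm_num) hmem1 (h.lie le_rfl (by norm_num) hmem1 hc')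
  have l7 : ⁅P (e 1), ⁅e 1, e 3⁆⁆ ∈ F 5 := h.lie le_rfl (by norm_num) (h.flag.mem_one _)
    (h.lie le_rfl (by norm_num) hmem1 hmem3)
  have l8 : ⁅e 1, ⁅P (e 1), e 3⁆⁆ ∈ F 5 := h.lie le_rfl (by norm_num) hmem1
    (h.lie le_rfl (by norm_num) (h.flag.mem_one _) hmem3)
  have l9 : (2 * c') • e 4 ∈ F 5 := by
    have l10 := (F 5).smul_mem ((((3 : ℕ) : k) - 1) * (3 : ℕ)) l2
    rw [l5] at l10
    convert sub_mem (sub_mem (sub_mem l10 l7) l8) l6 using 1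
    simp only [lie_sub, lie_smul, e12, e13]
    module
  have hc0' : c' = 0 := by simpa using h.eq_zero_of_smul_mem (by norm_num) (by omega) l9
  rw [hc0', zero_smul, sub_zero] at hc'
  exact ⟨hb, hc'⟩

/-- The diagonal part of a prederivation is a multiple of the degree. -/
theorem exists_prederivation_sub_mem (h : IsWittAdapted n F e) (hn : 6 ≤ n)
    (he : ∀ i, 2 ≤ i → ⁅e 1, e i⁆ = ((i : k) - 1) • e (i + 1)) (hP : IsPrederivation P) :
    ∃ a : k, ∀ i, 1 ≤ i → ∀ x ∈ F i, P x - (i * a) • x ∈ F (i + 1) := by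
  obtain ⟨hP2, hP3⟩ := h.prederivation_two_three_mem hn he hP
  obtain ⟨a, ha⟩ := h.exists_sub_smul_mem le_rfl (h.flag.mem_one (P (e 1)))
  obtain ⟨b, hb⟩ := h.exists_sub_smul_mem (by norm_num) hP2
  obtain ⟨c, hc⟩ := h.exists_sub_smul_mem (by norm_num) hP3
  have step : ∀ j, 2 ≤ j → ∀ d : k, P (e j) - d • e j ∈ F (j + 1) →
      P (e (j + 2)) - (a + a + d) • e (j + 2) ∈ F (j + 2 + 1) := by
    intro j hj d hd
    have h1 := h.prederivation_sub_mem hP le_rfl le_rfl (by omega) (h.mem 1 le_rfl)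
      (h.mem 1 le_rfl) (h.mem j (by omega)) ha ha hd
    obtain ⟨h0, h2, -⟩ := smul_map_add_two hP he hj
    rw [← h2, map_smul, smul_comm, ← smul_sub, Submodule.smul_mem_iff _ h0] at h1
    rwa [show 1 + 1 + j + 1 = j + 2 + 1 by omega] at h1
  have hdiag : ∀ d, (∃ c : k, P (e (d + 2)) - c • e (d + 2) ∈ F (d + 2 + 1)) ∧
      (∃ c : k, P (e (d + 3)) - c • e (d + 3) ∈ F (d + 3 + 1)) := by
    intro d
    induction d with
    | zero => exact ⟨⟨b, hb⟩, ⟨c, hc⟩⟩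
    | succ d ih =>
      obtain ⟨⟨x, hx⟩, hy⟩ := ih
      exact ⟨hy, ⟨_, step (d + 2) (by omega) x hx⟩⟩
  have hF : ∀ i, 2 ≤ i → ∀ x ∈ F i, P x ∈ F i := by
    intro i hi x hx
    refine h.map_mem_of_forall P (by omega) (fun j hj => ?_) hx
    obtain ⟨d, rfl⟩ : ∃ d, j = d + 2 := ⟨j - 2, by omega⟩
    obtain ⟨z, hz⟩ := (hdiag d).1
    refine h.flag.mem_of_le hj ?_
    have := add_mem (h.flag.mem_of_le (Nat.le_succ _) hz) ((F _).smul_mem z (h.mem (d + 2) (by omega)))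
    simpa using this
  have e12 : ⁅e 1, e 2⁆ = e 3 := by simpa [show (2 : k) - 1 = 1 by norm_num] using he 2 le_rfl
  have e15 : ⁅e 1, e 5⁆ = (4 : k) • e 6 := by
    simpa [show (5 : k) - 1 = 4 by norm_num] using he 5 (by norm_num)
  have hr := h.bracket 2 3 (by norm_num) (by norm_num)
  norm_num at hr
  have hm2 := h.mem 2 (by norm_num)
  have hm3 := h.mem 3 (by norm_num)
  -- Degree 5 is reached by `[e 2, [e 1, e 2]]` and `[e 1, [e 1, e 3]]`, degree 6 by `[e 1, [e 2, e
  -- 3]]` and by four applications of `ad (e 1)` to `e 2`. Equating weights gives two linear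
  -- equations that force `b = 2a` and `c = 3a`.
  have r5 : b + a + b = a + a + c := by
    have h1 := h.prederivation_sub_mem hP (by norm_num) le_rfl (by norm_num) hm2 (h.mem 1 le_rfl)
      hm2 hb ha hb
    rw [e12] at h1
    refine h.eq_of_sub_smul_mem (i := 5) (by norm_num) (by omega) ?_ (step 3 (by norm_num) c hc)
    convert add_mem (sub_mem h1 (hF 6 (by norm_num) _ hr)) ((F 6).smul_mem (b + a + b) hr) using 1
    rw [map_sub]
    module
  have r6 : a + b + c = a + a + (a + a + b) := by
    have h1 := h.prederivation_sub_mem hP le_rfl (by norm_num) (by norm_num) (h.mem 1 le_rfl)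
      hm2 hm3 ha hb hc
    refine h.eq_of_sub_smul_mem (i := 6) (by norm_num) (by omega) ?_
      (step 4 (by norm_num) _ (step 2 le_rfl b hb))
    have h2 := h.lie le_rfl (by norm_num) (h.mem 1 le_rfl) hr
    rw [lie_sub, e15] at h2
    have h4 : (4 : k) ≠ 0 := by norm_num
    rw [← Submodule.smul_mem_iff _ h4]
    convert add_mem (sub_mem h1 (hF 7 (by norm_num) _ h2)) ((F 7).smul_mem (a + b + c) h2) using 1
    rw [map_sub, map_smul]
    module
  have hc3 : c = 3 * a := by linear_combination r6
  have hb2 : b = 2 * a := by linear_combination (1 / 2) * r5 + (1 / 2) * hc3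
  have hdiag' : ∀ d, P (e (d + 2)) - ((d + 2 : ℕ) * a) • e (d + 2) ∈ F (d + 2 + 1) ∧
      P (e (d + 3)) - ((d + 3 : ℕ) * a) • e (d + 3) ∈ F (d + 3 + 1) := by
    intro d
    induction d with
    | zero => exact ⟨by simpa [hb2] using hb, by simpa [hc3] using hc⟩
    | succ d ih =>
      refine ⟨ih.2, ?_⟩
      have := step (d + 2) (by omega) _ ih.1
      convert this using 3
      push_cast
      ring
  have hdiag'' : ∀ i, 1 ≤ i → P (e i) - (i * a) • e i ∈ F (i + 1) := by
    intro i hi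
    rcases Nat.lt_or_ge i 2 with h2 | h2
    · obtain rfl : i = 1 := by omega
      simpa using ha
    · obtain ⟨d, rfl⟩ := Nat.exists_eq_add_of_le' h2
      exact (hdiag' d).1
  refine ⟨a, fun i hi x hx => ?_⟩
  obtain ⟨z, hz⟩ := h.exists_sub_smul_mem hi hx
  convert add_mem (sub_mem (hF _ (by omega) _ hz) ((F _).smul_mem (i * a) hz))
    ((F _).smul_mem z (hdiag'' i hi)) using 1
  rw [map_sub, map_smul]
  module

/-- A non-singular prederivation yields an adapted basis with homogeneous triple brackets, hence a
non-singular derivation. -/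
theorem hasNonsingularDerivation_of_prederivation {m : ℕ} (h : IsWittAdapted (m + 5) F e)
    (hm : 4 ≤ m) (he : ∀ i, 2 ≤ i → ⁅e 1, e i⁆ = ((i : k) - 1) • e (i + 1))
    (hP : IsPrederivation P) (hinj : Function.Injective P) : HasNonsingularDerivation k L := by
  obtain ⟨a, ha⟩ := h.exists_prederivation_sub_mem (by omega) he hP
  have ha0 : a ≠ 0 := by
    rintro rfl
    have h1 := ha (m + 5) (by omega) _ (h.mem (m + 5) (by omega))
    rw [mul_zero, zero_smul, sub_zero] at h1
    have h2 := h.flag.eq_zero (by omega) h1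
    rw [← map_zero P] at h2
    refine h.notMem (m + 5) (by omega) le_rfl ?_
    rw [hinj h2]
    exact zero_mem _
  have hne : ∀ i j : ℕ, i ≠ j → ((i : k) - j) * a ≠ 0 := fun i j hij =>
    mul_ne_zero (by rw [sub_ne_zero]; exact_mod_cast hij) ha0
  -- Triangular diagonalization: an error term in degree `j > i` is removed by dividing by the
  -- difference `(j - i) a` of the eigenvalues.
  have heig : ∀ i, 1 ≤ i → ∃ f, f - e i ∈ F (i + 1) ∧ P f = (i * a) • f := by
    intro i hi
    have key : ∀ d, ∃ f, f - e i ∈ F (i + 1) ∧ P f - (i * a) • f ∈ F (i + 1 + d) := by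
      intro d
      induction d with
      | zero => exact ⟨e i, by simp, ha i hi _ (h.mem i hi)⟩
      | succ d ih =>
        obtain ⟨f, hf, hPf⟩ := ih
        obtain ⟨c, hc⟩ := h.exists_sub_smul_mem (by omega) hPf
        set j := i + 1 + d with hj
        have hji := hne j i (by omega)
        have h1 := ha j (by omega) _ (h.mem j (by omega))
        refine ⟨f - (c * (((j : k) - i) * a)⁻¹) • e j, ?_, ?_⟩
        · have := sub_mem hf ((F (i + 1)).smul_mem (c * (((j : k) - i) * a)⁻¹)
            (h.flag.mem_of_le (by omega) (h.mem j (by omega))))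
          convert this using 1
          abel
        · have := sub_mem hc ((F (j + 1)).smul_mem (c * (((j : k) - i) * a)⁻¹) h1)
          rw [show i + 1 + (d + 1) = j + 1 by omega]
          convert this using 1
          rw [map_sub, map_smul]
          have hc' : c • e j = ((c * (((j : k) - i) * a)⁻¹) * (((j : k) - i) * a)) • e j := by
            rw [inv_mul_cancel_right₀ hji]
          rw [hc']
          module
    obtain ⟨f, hf, hPf⟩ := key (m + 5)
    exact ⟨f, hf, sub_eq_zero.1 (h.flag.eq_zero (by omega) hPf)⟩
  choose! f hf hPf using heig
  -- On `F j` only eigenvalues `i * a` with `i ≥ j` occur, so an eigenvector for a smaller degree is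
  -- zero there.
  have hzero : ∀ s j, 1 ≤ j → s < j → ∀ y ∈ F j, P y = ((s : k) * a) • y → y = 0 := by
    intro s j hj hsj y hy hPy
    have key : ∀ d, y ∈ F (j + d) := by
      intro d
      induction d with
      | zero => exact hy
      | succ d ih =>
        have h1 := ha (j + d) (by omega) y ih
        rw [hPy, ← sub_smul, ← sub_mul, Submodule.smul_mem_iff _ (hne _ _ (by omega))] at h1
        exact h1
    exact h.flag.eq_zero (by omega) (key (m + 5))
  have hmem : ∀ i, 1 ≤ i → f i ∈ F i := by
    intro i hi
    have := add_mem (h.flag.mem_of_le (Nat.le_succ i) (hf i hi)) (h.mem i hi)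
    simpa using this
  have hbr : ∀ i j, 1 ≤ i → 1 ≤ j → ⁅f i, f j⁆ - ((j : k) - i) • f (i + j) ∈ F (i + j + 1) := by
    intro i j hi hj
    have h1 := h.lie (by omega) hj (hf i hi) (hmem j hj)
    have h2 := h.lie hi (by omega) (h.mem i hi) (hf j hj)
    have h3 := (F (i + j + 1)).smul_mem ((j : k) - i) (hf (i + j) (by omega))
    rw [show i + 1 + j = i + j + 1 by omega] at h1
    convert sub_mem (add_mem (add_mem h1 h2) (h.bracket i j hi hj)) h3 using 1
    simp only [sub_lie, lie_sub]
    module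
  have hA : IsWittAdapted (m + 5) F f := by
    refine ⟨h.flag, h.lie, hmem, fun i hi hi' hfi => h.notMem i hi hi' ?_, hbr⟩
    have := sub_mem hfi (hf i hi)
    simpa using this
  refine hA.hasNonsingularDerivation_of_triple hm fun i j l hi hj hl => ?_
  rw [← sub_eq_zero]
  -- The deviation from homogeneity is an eigenvector of degree `i + j + l` lying one filtration
  -- step too deep.
  refine hzero (i + (j + l)) (i + (j + l) + 1) (by omega) (by omega) _ ?_ ?_
  · have h1 := h.lie hi (by omega) (hmem i hi) (hbr j l hj hl)
    have h2 := (F (i + (j + l) + 1)).smul_mem ((l : k) - j) (hbr i (j + l) hi (by omega))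
    rw [show i + (j + l + 1) = i + (j + l) + 1 by omega] at h1
    convert add_mem h1 h2 using 1
    rw [lie_sub, lie_smul]
    module
  · rw [map_sub, map_smul, hP, hPf i hi, hPf j hj, hPf l hl, hPf _ (by omega)]
    simp only [smul_lie, lie_smul]
    push_cast
    module

end IsWittAdapted

end Prederivation

end Filiform

/-! ### Rigidity of the graded structure constants. -/

namespace Filiform

section StructureConstants

variable {k : Type*} [Field k] [CharZero k] {n : ℕ} {g : ℕ → ℕ → k}

/-- If the structure constants of degree `s` are those of the Witt algebra and one structure
constant of degree `s + 1` is, then all of degree `s + 1` are. -/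
theorem structureConstants_eq_of_eq {s i₀ : ℕ} (hi₀ : 2 ≤ i₀) (his : i₀ + 2 ≤ s + 1)
    (h1 : ∀ i j, 2 ≤ i → 2 ≤ j → i + j = s →
      ((i : k) + j - 1) * g i j = (i - 1) * g (i + 1) j + (j - 1) * g i (j + 1))
    (hs : ∀ i j, 2 ≤ i → 2 ≤ j → i + j = s → g i j = j - i)
    (h0 : g i₀ (s + 1 - i₀) = ((s + 1 - i₀ : ℕ) : k) - i₀) :
    ∀ i j, 2 ≤ i → 2 ≤ j → i + j = s + 1 → g i j = j - i := by
  have hne : ∀ j : ℕ, 2 ≤ j → (j : k) - 1 ≠ 0 := fun j hj => by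
    rw [sub_ne_zero]; exact_mod_cast (by omega : j ≠ 1)
  -- The deviations from the Witt values satisfy a two-term recursion along `i + j = s + 1` with
  -- non-zero coefficients, so one zero spreads in both directions.
  have hrec : ∀ i j, 2 ≤ i → 2 ≤ j → i + j = s →
      ((i : k) - 1) * (g (i + 1) j - (j - (i + 1 : ℕ))) +
        ((j : k) - 1) * (g i (j + 1) - ((j + 1 : ℕ) - i)) = 0 := by
    intro i j hi hj hij
    have h2 := h1 i j hi hj hij
    rw [hs i j hi hj hij] at h2
    push_cast
    linear_combination -h2
  have hup : ∀ d, i₀ + d + 2 ≤ s + 1 →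
      g (i₀ + d) (s + 1 - (i₀ + d)) = ((s + 1 - (i₀ + d) : ℕ) : k) - (i₀ + d : ℕ) := by
    intro d
    induction d with
    | zero => intro _; simpa using h0
    | succ d ih =>
      intro hd
      have h2 := hrec (i₀ + d) (s - (i₀ + d)) (by omega) (by omega) (by omega)
      have h3 := ih (by omega)
      rw [show s + 1 - (i₀ + d) = s - (i₀ + d) + 1 by omega] at h3
      rw [h3, sub_self, mul_zero, add_zero] at h2
      have h4 := (mul_eq_zero.1 h2).resolve_left (hne _ (by omega))
      rw [show s + 1 - (i₀ + (d + 1)) = s - (i₀ + d) by omega]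
      exact sub_eq_zero.1 h4
  have hdown : ∀ d i, i + d = i₀ → 2 ≤ i → g i (s + 1 - i) = ((s + 1 - i : ℕ) : k) - i := by
    intro d
    induction d with
    | zero => rintro i rfl _; exact h0
    | succ d ih =>
      intro i hid hi
      have h2 := hrec i (s - i) hi (by omega) (by omega)
      have h3 := ih (i + 1) (by omega) (by omega)
      rw [show s + 1 - (i + 1) = s - i by omega] at h3
      rw [h3, sub_self, mul_zero, zero_add] at h2
      have h4 := (mul_eq_zero.1 h2).resolve_left (hne _ (by omega))
      rw [show s + 1 - i = s - i + 1 by omega]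
      exact sub_eq_zero.1 h4
  intro i j hi hj hij
  obtain rfl : j = s + 1 - i := by omega
  rcases Nat.le_total i i₀ with h | h
  · exact hdown (i₀ - i) i (by omega) hi
  · obtain ⟨d, rfl⟩ := Nat.exists_eq_add_of_le h
    exact hup d (by omega)

/-- The relations with `e_1` express every constant that occurs through `b = g 3 4`, `c = g 4 5` and
`d = g 5 6`. The Jacobi identities for `(2,3,4)`, `(2,4,5)`, `(3,4,5)`, of degrees 9, 11 and 12,
become three polynomial equations whose only solution with `b ≠ 0` has `b = c = 1`. -/
theorem structureConstants_low (hn : 12 ≤ n) (hanti : ∀ i j, g i j = -g j i)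
    (h1 : ∀ i j, 2 ≤ i → 2 ≤ j → i + j + 1 ≤ n →
      ((i : k) + j - 1) * g i j = (i - 1) * g (i + 1) j + (j - 1) * g i (j + 1))
    (hJ : ∀ i j l, 2 ≤ i → 2 ≤ j → 2 ≤ l → i + j + l ≤ n →
      g j l * g i (j + l) + g l i * g j (l + i) + g i j * g l (i + j) = 0)
    (h23 : g 2 3 = 1) (h34 : g 3 4 ≠ 0) : g 3 4 = 1 ∧ g 4 5 = 1 := by
  have hself : ∀ i, g i i = 0 := fun i => self_eq_neg.1 (hanti i i)
  have a1 := h1 2 3 (by norm_num) (by norm_num) (by omega)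
  have a2 := h1 2 4 (by norm_num) (by norm_num) (by omega)
  have a3 := h1 2 5 (by norm_num) (by norm_num) (by omega)
  have a4 := h1 3 4 (by norm_num) (by norm_num) (by omega)
  have a5 := h1 2 6 (by norm_num) (by norm_num) (by omega)
  have a6 := h1 3 5 (by norm_num) (by norm_num) (by omega)
  have a7 := h1 2 7 (by norm_num) (by norm_num) (by omega)
  have a8 := h1 3 6 (by norm_num) (by norm_num) (by omega)
  have a9 := h1 4 5 (by norm_num) (by norm_num) (by omega)
  have a10 := h1 2 8 (by norm_num) (by norm_num) (by omega)
  have a11 := h1 3 7 (by norm_num) (by norm_num) (by omega)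
  have a12 := h1 4 6 (by norm_num) (by norm_num) (by omega)
  have a13 := h1 3 8 (by norm_num) (by norm_num) (by omega)
  have a14 := h1 4 7 (by norm_num) (by norm_num) (by omega)
  have a15 := h1 5 6 (by norm_num) (by norm_num) (by omega)
  have j1 := hJ 2 3 4 (by norm_num) (by norm_num) (by norm_num) (by omega)
  have j2 := hJ 2 4 5 (by norm_num) (by norm_num) (by norm_num) (by omega)
  have j3 := hJ 3 4 5 (by norm_num) (by norm_num) (by norm_num) (by omega)
  rw [hanti 4 2] at j1
  rw [hanti 5 2] at j2
  rw [hanti 5 3] at j3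
  have s3 := hself 3
  have s4 := hself 4
  have s5 := hself 5
  have s6 := hself 6
  simp only [Nat.reduceAdd, s3, s4, s5, s6, h23, Nat.cast_ofNat] at *
  set b := g 3 4
  set c := g 4 5
  set d := g 5 6
  have g24 : g 2 4 = 2 := by linear_combination (-1 / 2) * a1
  have g25 : g 2 5 = (10 - b) / 3 := by linear_combination (-1 / 3) * a2 + (5 / 3) * g24
  have g35 : g 3 5 = 2 * b := by linear_combination (-1 / 3) * a4
  have g26 : g 2 6 = 5 - b := by linear_combination (-1 / 4) * a3 + (6 / 4) * g25 - (1 / 4) * g35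
  have g36 : g 3 6 = (7 * b - c) / 2 := by linear_combination (-1 / 4) * a6 + (7 / 4) * g35
  have g27 : g 2 7 = (70 - 21 * b + c) / 10 := by
    linear_combination (-1 / 5) * a5 + (7 / 5) * g26 - (1 / 5) * g36
  have g46 : g 4 6 = 2 * c := by linear_combination (-1 / 4) * a9
  have g37 : g 3 7 = (28 * b - 8 * c) / 5 := by
    linear_combination (-1 / 5) * a8 + (8 / 5) * g36 - (2 / 5) * g46
  have g28 : g 2 8 = (8 * g 2 7 - g 3 7) / 6 := by linear_combination (-1 / 6) * a7
  have g47 : g 4 7 = (18 * c - 3 * d) / 5 := by linear_combination (-1 / 5) * a12 + (9 / 5) * g46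
  have g38 : g 3 8 = (9 * g 3 7 - 2 * g 4 7) / 6 := by linear_combination (-1 / 6) * a11
  have g29 : g 2 9 = (9 * g 2 8 - g 3 8) / 7 := by linear_combination (-1 / 7) * a10
  have g57 : g 5 7 = 2 * d := by linear_combination (-1 / 5) * a15
  have g48 : g 4 8 = (10 * g 4 7 - 3 * g 5 7) / 6 := by linear_combination (-1 / 6) * a14
  have g39 : g 3 9 = (10 * g 3 8 - 2 * g 4 8) / 7 := by linear_combination (-1 / 7) * a13
  rw [g39, g38, g48, g57, g37, g47, g35] at j3
  rw [g29, g28, g38, g27, g37, g47, g25, g24] at j2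
  rw [g27, g24, g36] at j1
  have E1 : c * (20 + b) = 21 * b ^ 2 := by linear_combination 10 * j1
  have E2 : d * (7 * b + c) = 8 * c ^ 2 := by linear_combination (7 / 6) * j3
  have E3 : d * (140 - 7 * b - c) = 168 * b * c - 36 * c ^ 2 := by linear_combination 35 * j2
  have hc : c ≠ 0 := by
    intro h
    rw [h, zero_mul] at E1
    have : b ^ 2 = 0 := by linear_combination (-1 / 21) * E1
    exact h34 (pow_eq_zero_iff two_ne_zero |>.1 this)
  -- Elimination of `d` from `E2` and `E3`; combined with `E1` the result collapses to `c (c - b) =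
  -- 0`.
  have E4 : c * (40 * c + b * c + c ^ 2 - 42 * b ^ 2) = 0 := by
    linear_combination (-1 / 28) * ((140 - 7 * b - c) * E2 - (7 * b + c) * E3)
  have E5 := (mul_eq_zero.1 E4).resolve_left hc
  have E6 : c * (c - b) = 0 := by linear_combination E5 - 2 * E1
  have E7 : c = b := sub_eq_zero.1 ((mul_eq_zero.1 E6).resolve_left hc)
  have E8 : (20 * b) * (b - 1) = 0 := by
    rw [E7] at E1
    linear_combination -E1
  have E9 : b = 1 := sub_eq_zero.1 ((mul_eq_zero.1 E8).resolve_left (by simpa using h34))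
  exact ⟨E9, E7.trans E9⟩

/-- Graded structure constants of a filiform Lie algebra with `g 2 3` and `g 3 4` non-zero are
those of the Witt algebra. -/
theorem structureConstants_eq (hn : 12 ≤ n) (hanti : ∀ i j, g i j = -g j i)
    (h1 : ∀ i j, 2 ≤ i → 2 ≤ j → i + j + 1 ≤ n →
      ((i : k) + j - 1) * g i j = (i - 1) * g (i + 1) j + (j - 1) * g i (j + 1))
    (hJ : ∀ i j l, 2 ≤ i → 2 ≤ j → 2 ≤ l → i + j + l ≤ n →
      g j l * g i (j + l) + g l i * g j (l + i) + g i j * g l (i + j) = 0)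
    (h23 : g 2 3 = 1) (h34 : g 3 4 ≠ 0) :
    ∀ i j, 2 ≤ i → 2 ≤ j → i + j ≤ n → g i j = j - i := by
  obtain ⟨g34, g45⟩ := structureConstants_low hn hanti h1 hJ h23 h34
  have hself : ∀ i, g i i = 0 := fun i => self_eq_neg.1 (hanti i i)
  have key : ∀ s, 4 ≤ s → s ≤ n → ∀ i j, 2 ≤ i → 2 ≤ j → i + j = s → g i j = j - i := by
    intro s
    induction s using Nat.strong_induction_on with
    | _ s ih =>
    intro hs4 hsn
    rcases Nat.eq_or_lt_of_le hs4 with rfl | hs5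
    · intro i j hi hj hij
      obtain rfl : i = 2 := by omega
      obtain rfl : j = 2 := by omega
      simp [hself]
    obtain ⟨t, rfl⟩ : ∃ t, s = t + 1 := ⟨s - 1, by omega⟩
    have h1' : ∀ i j, 2 ≤ i → 2 ≤ j → i + j = t →
        ((i : k) + j - 1) * g i j = (i - 1) * g (i + 1) j + (j - 1) * g i (j + 1) :=
      fun i j hi hj hij => h1 i j hi hj (by omega)
    have hst := ih t (by omega) (by omega) (by omega)
    -- In even degree the anchor is `g p p = 0`. In degrees 5, 7, 9 it is `g 2 3`, `g 3 4` or `g 4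
    -- 5`.
    rcases Nat.even_or_odd' (t + 1) with ⟨p, hp | hp⟩
    · refine structureConstants_eq_of_eq (i₀ := p) (by omega) (by omega) h1' hst ?_
      rw [show t + 1 - p = p by omega, hself, sub_self]
    rcases Nat.lt_or_ge t 10 with ht | ht
    · refine structureConstants_eq_of_eq (i₀ := p) (by omega) (by omega) h1' hst ?_
      obtain rfl | rfl | rfl : p = 2 ∨ p = 3 ∨ p = 4 := by omega
      · obtain rfl : t = 4 := by omega
        norm_num [h23]
      · obtain rfl : t = 6 := by omega
        norm_num [g34]
      · obtain rfl : t = 8 := by omega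
        norm_num [g45]
    -- In odd degree `m + 5 ≥ 11` the Jacobi identity for `(2, 3, m)` and three relations with `e_1`
    -- form a linear system in `g 2 (m+3)`, `g 3 (m+2)`, `g 4 (m+1)`, `g 5 m`. Eliminating the last
    -- three leaves the coefficient `hpos`, which is positive as a polynomial in `m - 3`.
    obtain ⟨m, rfl⟩ : ∃ m, t = m + 4 := ⟨t - 4, by omega⟩
    refine structureConstants_eq_of_eq (i₀ := 2) le_rfl (by omega) h1' hst ?_
    have r2 := h1' 2 (m + 2) (by norm_num) (by omega) (by omega)
    have r3 := h1' 3 (m + 1) (by norm_num) (by omega) (by omega)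
    have r4 := h1' 4 m (by norm_num) (by omega) (by omega)
    rw [hst 2 (m + 2) (by norm_num) (by omega) (by omega)] at r2
    rw [hst 3 (m + 1) (by norm_num) (by omega) (by omega)] at r3
    rw [hst 4 m (by norm_num) (by omega) (by omega)] at r4
    have hJm := hJ 2 3 m (by norm_num) (by norm_num) (by omega) (by omega)
    rw [h23, ih (3 + m) (by omega) (by omega) (by omega) 3 m (by norm_num) (by omega) rfl,
      ih (m + 2) (by omega) (by omega) (by omega) m 2 (by omega) (by norm_num) rfl,
      hanti m, show 3 + m = m + 3 by omega] at hJm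
    simp only [Nat.reduceAdd, add_assoc] at r2 r3 r4 hJm
    rw [show m + 4 + 1 - 2 = m + 3 by omega]
    push_cast at r2 r3 r4 hJm ⊢
    have hpos : (6 * ((m - 3) + (m - 2) * (m + 1)) + (m - 1) * m * (m + 1) : k) ≠ 0 := by
      obtain ⟨q, rfl⟩ : ∃ q, m = q + 3 := ⟨m - 3, by omega⟩
      have : (6 * (q + (q + 1) * (q + 4)) + (q + 2) * (q + 3) * (q + 4) : k) ≠ 0 := by
        exact_mod_cast (by positivity :
          6 * (q + (q + 1) * (q + 4)) + (q + 2) * (q + 3) * (q + 4) ≠ 0)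
      convert this using 1
      push_cast
      ring
    rw [← sub_eq_zero]
    refine (mul_eq_zero.1 ?_).resolve_left hpos
    linear_combination 6 * hJm - (6 * (m - 2) + (m - 1) * m) * r2 - 2 * r4 + (m - 1) * r3
  exact fun i j hi hj hij => key (i + j) (by omega) hij i j hi hj rfl

end StructureConstants

end Filiform

/-! ### Vergne's filtration theorem. -/

namespace Filiform

section FiliformFlag

variable {k : Type*} {L : Type*} [Field k] [LieRing L] [LieAlgebra k L]

/-- The properties of the flag formed by the lower central series of a filiform Lie algebra,
completed by a suitable subspace `F 2` of codimension one. -/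
structure IsFiliformFlag (n : ℕ) (F : ℕ → Submodule k L) : Prop extends IsFullFlag n F where
  lie_mem : ∀ {i : ℕ} (x : L) {y : L}, 2 ≤ i → y ∈ F i → ⁅x, y⁆ ∈ F (i + 1)
  -- This is `[L^a, L^b] ⊆ L^(a+b+1)` after the index shift by two, one degree short of a
  -- filtration.
  lie_mem' : ∀ {i j : ℕ} {x y : L}, 2 ≤ i → 2 ≤ j → x ∈ F i → y ∈ F j → ⁅x, y⁆ ∈ F (i + j - 1)
  le_of_lie_mem : ∀ {i : ℕ} (S : Submodule k L), 2 ≤ i →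
    (∀ x : L, ∀ y ∈ F i, ⁅x, y⁆ ∈ S) → F (i + 1) ≤ S
  lie_two_three : ∀ {x y : L}, x ∈ F 2 → y ∈ F 3 → ⁅x, y⁆ ∈ F 5
  lie_middle : ∀ {p : ℕ} {x y : L}, 3 ≤ p → n = 2 * p → x ∈ F p → y ∈ F p → ⁅x, y⁆ = 0

namespace IsFiliformFlag

variable {n : ℕ} {F : ℕ → Submodule k L} {a : L} {E : ℕ → L}

theorem iterate_mem (hF : IsFiliformFlag n F) (h2 : E 2 ∈ F 2)
    (hE : ∀ i, 2 ≤ i → E (i + 1) = ⁅a, E i⁆) : ∀ i, 2 ≤ i → E i ∈ F i := by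
  intro i hi
  induction i, hi using Nat.le_induction with
  | base => exact h2
  | succ i hi ih =>
    rw [hE i hi]
    exact hF.lie_mem a hi ih

variable [Module.Finite k L]

/-- If `F 2` raises the degree of `F i` by two then `ad a` maps `F i` onto `F (i + 1)` modulo
`F (i + 2)`. -/
theorem lie_notMem (hF : IsFiliformFlag n F) (ha : a ∉ F 2) {i : ℕ} (hi : 2 ≤ i) (hin : i + 1 ≤ n)
    (h : ∀ x ∈ F 2, ∀ y ∈ F i, ⁅x, y⁆ ∈ F (i + 2)) {g : L} (hg : g ∈ F i)
    (hg' : g ∉ F (i + 1)) : ⁅a, g⁆ ∉ F (i + 2) := by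
  intro hag
  have hle : F (i + 1) ≤ F (i + 2) := by
    refine hF.le_of_lie_mem _ hi fun x y hy => ?_
    obtain ⟨c, hc⟩ := hF.exists_sub_smul_mem le_rfl (hF.mem_one a) ha (hF.mem_one x)
    obtain ⟨d, hd⟩ := hF.exists_sub_smul_mem (by omega) hg hg' hy
    have h1 := h _ hc y hy
    have h2 := hF.lie_mem a (by omega) hd
    have h3 := add_mem h1 ((F (i + 2)).smul_mem c (add_mem h2 ((F (i + 2)).smul_mem d hag)))
    convert h3 using 1
    simp only [sub_lie, lie_sub, smul_lie, lie_smul]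
    module
  obtain ⟨z, hz, hz'⟩ := hF.exists_mem_notMem (by omega) hin
  exact hz' (hle hz)

/-- For use inside the induction on `t`: the iterates of `ad a` are adapted to the flag as far as
the filtration property is already known. -/
theorem iterate_notMem (hF : IsFiliformFlag n F) (ha : a ∉ F 2) (h2 : E 2 ∈ F 2)
    (h2' : E 2 ∉ F 3) (hE : ∀ i, 2 ≤ i → E (i + 1) = ⁅a, E i⁆) {t : ℕ}
    (ht : ∀ s < t, ∀ i j, 2 ≤ i → 2 ≤ j → i + j = s → ∀ x ∈ F i, ∀ y ∈ F j, ⁅x, y⁆ ∈ F s) :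
    ∀ i, 2 ≤ i → i + 2 ≤ t → i ≤ n → E i ∉ F (i + 1) := by
  intro i hi
  induction i, hi using Nat.le_induction with
  | base => exact fun _ _ => h2'
  | succ i hi ih =>
    intro hit hin
    rw [hE i hi]
    exact hF.lie_notMem ha hi hin
      (ht (i + 2) (by omega) 2 i le_rfl hi (by omega)) (hF.iterate_mem h2 hE i hi)
      (ih (by omega) (by omega))

omit [Module.Finite k L] in
/-- The alternating rule for the leading coefficients of brackets. -/
theorem alternating {ψ : L →ₗ[k] k} (hF : IsFiliformFlag n F) (h2 : E 2 ∈ F 2)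
    (hE : ∀ i, 2 ≤ i → E (i + 1) = ⁅a, E i⁆) {t : ℕ}
    (ht : ∀ i j, 2 ≤ i → 2 ≤ j → i + j = t → ∀ x ∈ F i, ∀ y ∈ F j, ⁅x, y⁆ ∈ F t)
    (hψ : ∀ x ∈ F (t + 1), ψ x = 0) (d : ℕ) (hd : d + 4 ≤ t + 1) :
    ψ ⁅E (d + 2), E (t + 1 - (d + 2))⁆ = (-1) ^ d * ψ ⁅E 2, E (t + 1 - 2)⁆ := by
  have hm := hF.iterate_mem h2 hE
  induction d with
  | zero => simp
  | succ d ih =>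
    have h1 := ih (by omega)
    -- `ad a` sends a bracket of total degree `t` into `F (t + 1)`, where `ψ` vanishes; by Leibniz
    -- neighbouring values cancel.
    have h3 := hψ _ (hF.lie_mem a (by omega) (ht (d + 2) (t - (d + 2)) (by omega) (by omega)
      (by omega) _ (hm _ (by omega)) _ (hm _ (by omega))))
    rw [leibniz_lie, ← hE _ (by omega), ← hE _ (by omega), map_add,
      show t - (d + 2) + 1 = t + 1 - (d + 2) by omega, h1] at h3
    rw [show d + 1 + 2 = d + 2 + 1 by omega, show t + 1 - (d + 2 + 1) = t - (d + 2) by omega,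
      pow_succ]
    linear_combination h3

variable [CharZero k]

/-- The induction step for odd degree below the top. -/
theorem odd_step (hF : IsFiliformFlag n F) (ha : a ∉ F 2) (h2 : E 2 ∈ F 2)
    (h2' : E 2 ∉ F 3) (hE : ∀ i, 2 ≤ i → E (i + 1) = ⁅a, E i⁆) {p : ℕ} (hp : 3 ≤ p) (hpn : 2 * p + 1 ≤ n)
    (ht : ∀ i j, 2 ≤ i → 2 ≤ j → i + j = 2 * p → ∀ x ∈ F i, ∀ y ∈ F j, ⁅x, y⁆ ∈ F (2 * p))
    {z : L} {ψ : L →ₗ[k] k} (hz : z ∈ F (2 * p)) (hψ1 : ψ z = 1)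
    (hψ0 : ∀ x ∈ F (2 * p + 1), ψ x = 0)
    (hψ : ∀ x ∈ F (2 * p), x - ψ x • z ∈ F (2 * p + 1)) :
    ψ ⁅E 2, E (2 * p + 1 - 2)⁆ = 0 := by
  have hm := hF.iterate_mem h2 hE
  have halt := hF.alternating h2 hE ht hψ0
  set β := ψ ⁅E 2, E (2 * p + 1 - 2)⁆ with hβ
  -- A non-zero `β` is refuted one degree higher: there the coefficients are multiples of `β`
  -- growing linearly in `d`, yet the middle bracket `[E (p+1), E (p+1)]` is zero. This needs `F
  -- (2p+1) ≠ 0`, hence `2p + 1 ≤ n`.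
  by_contra hβ0
  have hz' : z ∉ F (2 * p + 1) := fun h => by
    rw [hψ0 z h] at hψ1
    exact zero_ne_one hψ1
  obtain ⟨w, hw, hw'⟩ := hF.exists_mem_notMem (i := 2 * p + 1) (by omega) hpn
  obtain ⟨φ, -, hφ0, hφ⟩ := hF.exists_functional (by omega) hw hw'
  have hφlie : ∀ u : L, ∀ x ∈ F (2 * p), φ ⁅u, x⁆ = ψ x * φ ⁅u, z⁆ := by
    intro u x hx
    have h1 := hφ0 _ (hF.lie_mem u (by omega) (hψ x hx))
    rw [lie_sub, map_sub, lie_smul, map_smul, smul_eq_mul] at h1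
    exact sub_eq_zero.1 h1
  -- the action of `E 2` on the leading term vanishes
  have hE2z : φ ⁅E 2, z⁆ = 0 := by
    have m3 := hm 3 (by norm_num)
    have mt := hm (2 * p - 2) (by omega)
    have h35 : ⁅E 3, E (2 * p - 2)⁆ ∈ F (2 * p) := by
      have := hF.lie_mem' (by norm_num) (by omega) m3 mt
      rwa [show 3 + (2 * p - 2) - 1 = 2 * p by omega] at this
    have e1 := hφlie (E 2) _ h35
    have e2 := halt 1 (by omega)
    rw [show 2 * p + 1 - (1 + 2) = 2 * p - 2 by omega, show 1 + 2 = 3 from rfl] at e2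
    rw [e2, leibniz_lie, map_add] at e1
    have e3 : φ ⁅⁅E 2, E 3⁆, E (2 * p - 2)⁆ = 0 := by
      refine hφ0 _ ?_
      have := hF.lie_mem' (by norm_num) (by omega) (hF.lie_two_three h2 m3) mt
      rwa [show 5 + (2 * p - 2) - 1 = 2 * p + 1 + 1 by omega] at this
    have e4 : φ ⁅E 3, ⁅E 2, E (2 * p - 2)⁆⁆ = 0 := by
      refine hφ0 _ ?_
      have := hF.lie_mem' (by norm_num) (by omega) m3
        (ht 2 (2 * p - 2) le_rfl (by omega) (by omega) _ h2 _ mt)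
      rwa [show 3 + 2 * p - 1 = 2 * p + 1 + 1 by omega] at this
    rw [e3, e4] at e1
    have e5 : β * φ ⁅E 2, z⁆ = 0 := by linear_combination e1
    exact (mul_eq_zero.1 e5).resolve_left hβ0
  -- If `a` also annihilated `z` modulo `F (2p+2)`, nothing would generate `F (2p+1)` modulo `F
  -- (2p+2)`.
  have haz : φ ⁅a, z⁆ ≠ 0 := by
    intro h0
    have hle : F (2 * p + 1) ≤ F (2 * p + 1 + 1) := by
      refine hF.le_of_lie_mem _ (by omega) fun x y hy => ?_
      have hxy : φ ⁅x, y⁆ = 0 := by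
        rw [hφlie x y hy]
        obtain ⟨c, hc⟩ := hF.exists_sub_smul_mem le_rfl (hF.mem_one a) ha (hF.mem_one x)
        obtain ⟨d, hd⟩ := hF.exists_sub_smul_mem (by norm_num) h2 h2' hc
        have h3 : φ ⁅x - c • a - d • E 2, z⁆ = 0 := by
          refine hφ0 _ ?_
          have := hF.lie_mem' (by norm_num) (by omega) hd hz
          rwa [show 2 + 1 + 2 * p - 1 = 2 * p + 1 + 1 by omega] at this
        simp only [sub_lie, smul_lie, map_sub, map_smul, h0, hE2z, smul_zero, sub_zero] at h3
        rw [h3, mul_zero]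
      have h4 := hφ _ (hF.lie_mem x (by omega) hy)
      rwa [hxy, zero_smul, sub_zero] at h4
    exact hw' (hle hw)
  have hβ' : ∀ d, d + 4 ≤ 2 * p + 2 → φ ⁅E (d + 2), E (2 * p + 2 - (d + 2))⁆ =
      (-1) ^ (d + 1) * d * (φ ⁅a, z⁆ * β) := by
    intro d
    have hstep : ∀ i, 2 ≤ i → i + 2 ≤ 2 * p + 1 → ⁅E i, E (2 * p + 1 - i)⁆ ∈ F (2 * p) := by
      intro i hi hi'
      have := hF.lie_mem' hi (by omega) (hm i hi) (hm (2 * p + 1 - i) (by omega))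
      rwa [show i + (2 * p + 1 - i) - 1 = 2 * p by omega] at this
    induction d with
    | zero =>
      intro _
      have h3 := hφlie (E 2) _ (hm (2 * p) (by omega))
      rw [hE2z, mul_zero] at h3
      simpa using h3
    | succ d ih =>
      intro hd
      have h1 := ih (by omega)
      have h3 := hφlie a _ (hstep (d + 2) (by omega) (by omega))
      rw [halt d (by omega), leibniz_lie, ← hE _ (by omega), ← hE _ (by omega), map_add,
        show 2 * p + 1 - (d + 2) + 1 = 2 * p + 2 - (d + 2) by omega, h1] at h3
      rw [show d + 1 + 2 = d + 2 + 1 by omega,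
        show 2 * p + 2 - (d + 2 + 1) = 2 * p + 1 - (d + 2) by omega]
      rw [Nat.cast_add, Nat.cast_one]
      linear_combination h3
  have h5 := hβ' (p - 1) (by omega)
  rw [show p - 1 + 2 = p + 1 by omega, show 2 * p + 2 - (p + 1) = p + 1 by omega, lie_self,
    map_zero] at h5
  have hp1 : ((p - 1 : ℕ) : k) ≠ 0 := by exact_mod_cast (by omega : p - 1 ≠ 0)
  exact mul_ne_zero (mul_ne_zero (pow_ne_zero _ (neg_ne_zero.2 one_ne_zero)) hp1)
    (mul_ne_zero haz hβ0) h5.symm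

/-- Vergne's theorem: the flag is a filtration. -/
theorem lie_mem_add (hF : IsFiliformFlag n F) (hn : 6 ≤ n) {i j : ℕ} {x y : L} (hi : 2 ≤ i)
    (hj : 2 ≤ j) (hx : x ∈ F i) (hy : y ∈ F j) : ⁅x, y⁆ ∈ F (i + j) := by
  obtain ⟨a, -, ha⟩ := hF.exists_mem_notMem le_rfl (by omega : 1 ≤ n)
  obtain ⟨b, h2, h2'⟩ := hF.exists_mem_notMem (by norm_num) (by omega : 2 ≤ n)
  obtain ⟨E, hE2, hE⟩ : ∃ E : ℕ → L, E 2 = b ∧ ∀ i, 2 ≤ i → E (i + 1) = ⁅a, E i⁆ := by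
    refine ⟨fun i => (fun v => ⁅a, v⁆)^[i - 2] b, rfl, fun i hi => ?_⟩
    simp only
    rw [show i + 1 - 2 = (i - 2) + 1 by omega, Function.iterate_succ_apply']
  rw [← hE2] at h2 h2'
  have hm := hF.iterate_mem h2 hE
  have key : ∀ t, ∀ i j, 2 ≤ i → 2 ≤ j → i + j = t → ∀ x ∈ F i, ∀ y ∈ F j, ⁅x, y⁆ ∈ F t := by
    intro t
    induction t using Nat.strong_induction_on with
    | _ t ih =>
    intro i j hi hj hij x hx y hy
    rcases Nat.lt_or_ge (n + 1) t with htn | htn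
    · have h1 := hF.lie_mem' hi hj hx hy
      rw [hF.eq_zero (by omega) h1]
      exact zero_mem _
    rcases Nat.lt_or_ge t 6 with ht6 | ht6
    · have : (i = 2 ∧ j = 2) ∨ (i = 2 ∧ j = 3) ∨ (i = 3 ∧ j = 2) := by omega
      rcases this with ⟨rfl, rfl⟩ | ⟨rfl, rfl⟩ | ⟨rfl, rfl⟩
      · subst hij
        obtain ⟨c, hc⟩ := hF.exists_sub_smul_mem (by norm_num) h2 h2' hx
        obtain ⟨d, hd⟩ := hF.exists_sub_smul_mem (by norm_num) h2 h2' hy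
        have h3 := neg_mem (hF.lie_two_three hy hc)
        rw [lie_skew] at h3
        have h4 := hF.mem_of_le (i := 2 + 2) (by norm_num)
          (add_mem h3 ((F 5).smul_mem c (hF.lie_two_three h2 hd)))
        convert h4 using 1
        simp only [sub_lie, lie_sub, smul_lie, lie_smul, lie_self]
        module
      · subst hij
        exact hF.lie_two_three hx hy
      · subst hij
        rw [← lie_skew]
        exact neg_mem (hF.lie_two_three hy hx)
    obtain ⟨s, rfl⟩ : ∃ s, t = s + 1 := ⟨t - 1, by omega⟩
    obtain ⟨z, hz, hz'⟩ := hF.exists_mem_notMem (i := s) (by omega) (by omega)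
    obtain ⟨ψ, hψ1, hψ0, hψ⟩ := hF.exists_functional (by omega) hz hz'
    have hs := ih s (by omega)
    have halt := hF.alternating h2 hE hs hψ0
    -- All coefficients in degree `s + 1` agree up to sign, so one suffices: the middle bracket in
    -- even degree, `lie_middle` in the top odd degree `n + 1`, and `odd_step` in lower odd degrees.
    have hzero : ψ ⁅E 2, E (s + 1 - 2)⁆ = 0 := by
      have hneg : ∀ d : ℕ, ((-1 : k)) ^ d ≠ 0 := fun d =>
        pow_ne_zero _ (neg_ne_zero.2 one_ne_zero)
      rcases Nat.even_or_odd' (s + 1) with ⟨p, hp | hp⟩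
      · have h3 := halt (p - 2) (by omega)
        rw [show p - 2 + 2 = p by omega, show s + 1 - p = p by omega, lie_self, map_zero] at h3
        exact (mul_eq_zero.1 h3.symm).resolve_left (hneg _)
      · obtain rfl : s = 2 * p := by omega
        rcases Nat.eq_or_lt_of_le htn with hsn | hsn
        · have h3 := halt (p - 2) (by omega)
          rw [show p - 2 + 2 = p by omega, show 2 * p + 1 - p = p + 1 by omega,
            hF.lie_middle (by omega) (by omega) (hm p (by omega))
              (hF.mem_of_le (Nat.le_succ p) (hm (p + 1) (by omega))), map_zero] at h3
          exact (mul_eq_zero.1 h3.symm).resolve_left (hneg _)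
        · exact hF.odd_step ha h2 h2' hE (by omega) (by omega) hs hz hψ1 hψ0 hψ
    have hmem : ⁅E i, E j⁆ ∈ F (s + 1) := by
      have h3 := hF.lie_mem' hi hj (hm i hi) (hm j hj)
      rw [hij, Nat.add_sub_cancel] at h3
      have h4 := halt (i - 2) (by omega)
      rw [show i - 2 + 2 = i by omega, show s + 1 - i = j by omega, hzero, mul_zero] at h4
      have h5 := hψ _ h3
      rwa [h4, zero_smul, sub_zero] at h5
    have hnot := hF.iterate_notMem ha h2 h2' hE (t := s + 1) ih
    obtain ⟨c, hc⟩ := hF.exists_sub_smul_mem (by omega) (hm i hi)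
      (hnot i hi (by omega) (by omega)) hx
    obtain ⟨d, hd⟩ := hF.exists_sub_smul_mem (by omega) (hm j hj)
      (hnot j hj (by omega) (by omega)) hy
    have h3 := hF.lie_mem' (by omega) hj hc hy
    have h4 := hF.lie_mem' hi (by omega) (hm i hi) hd
    rw [show i + 1 + j - 1 = s + 1 by omega] at h3
    rw [show i + (j + 1) - 1 = s + 1 by omega] at h4
    have h5 := add_mem h3 ((F (s + 1)).smul_mem c (add_mem h4 ((F (s + 1)).smul_mem d hmem)))
    convert h5 using 1
    simp only [sub_lie, lie_sub, smul_lie, lie_smul]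
    module
  exact key (i + j) i j hi hj rfl x hx y hy

end IsFiliformFlag

end FiliformFlag

end Filiform

/-! ### The associated graded algebra is of Witt type. -/

namespace Filiform

section WittAdapted

variable {k : Type*} {L : Type*} [Field k] [CharZero k] [LieRing L] [LieAlgebra k L]
  [Module.Finite k L] {n : ℕ} {F : ℕ → Submodule k L}

namespace IsFiliformFlag

theorem lie_mem_add_of_pos (hF : IsFiliformFlag n F) (hn : 6 ≤ n) {i j : ℕ} {x y : L} (hi : 1 ≤ i)
    (hj : 1 ≤ j) (hx : x ∈ F i) (hy : y ∈ F j) : ⁅x, y⁆ ∈ F (i + j) := by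
  rcases Nat.eq_or_lt_of_le hi with rfl | hi
  · rcases Nat.eq_or_lt_of_le hj with rfl | hj
    · obtain ⟨a, ha, ha'⟩ := hF.exists_mem_notMem le_rfl (by omega : 1 ≤ n)
      obtain ⟨c, hc⟩ := hF.exists_sub_smul_mem le_rfl ha ha' hx
      obtain ⟨d, hd⟩ := hF.exists_sub_smul_mem le_rfl ha ha' hy
      have h1 := hF.lie_mem y le_rfl hc
      have h2 := hF.lie_mem a le_rfl hd
      have h3 := hF.mem_of_le (i := 1 + 1) (by norm_num) (sub_mem ((F 3).smul_mem c h2) h1)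
      convert h3 using 1
      rw [← lie_skew x y]
      simp only [lie_sub, lie_smul, lie_self]
      rw [← lie_skew y a]
      module
    · have := hF.lie_mem x hj hy
      rwa [add_comm] at this
  · rcases Nat.eq_or_lt_of_le hj with rfl | hj
    · rw [← lie_skew]
      exact neg_mem (hF.lie_mem y hi hx)
    · exact hF.lie_mem_add hn hi hj hx hy

/-- A filtered basis with `⁅e 1, e i⁆ = (i - 1) e (i + 1)` and `⁅e 2, e 3⁆ ≡ e 5`. -/
theorem exists_basis (hF : IsFiliformFlag n F) (hn : 6 ≤ n)
    (hA : ¬ ∀ x ∈ F 2, ∀ y ∈ F 3, ⁅x, y⁆ ∈ F 6) :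
    ∃ e : ℕ → L, (∀ i, 1 ≤ i → e i ∈ F i) ∧ (∀ i, 1 ≤ i → i ≤ n → e i ∉ F (i + 1)) ∧
      (∀ i, 2 ≤ i → ⁅e 1, e i⁆ = ((i : k) - 1) • e (i + 1)) ∧ ⁅e 2, e 3⁆ - e 5 ∈ F 6 := by
  obtain ⟨a, -, ha⟩ := hF.exists_mem_notMem le_rfl (by omega : 1 ≤ n)
  obtain ⟨b, h2, h2'⟩ := hF.exists_mem_notMem (by norm_num) (by omega : 2 ≤ n)
  obtain ⟨E, hE2, hE⟩ : ∃ E : ℕ → L, E 2 = b ∧ ∀ i, 2 ≤ i → E (i + 1) = ⁅a, E i⁆ := by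
    refine ⟨fun i => (fun v => ⁅a, v⁆)^[i - 2] b, rfl, fun i hi => ?_⟩
    simp only
    rw [show i + 1 - 2 = (i - 2) + 1 by omega, Function.iterate_succ_apply']
  rw [← hE2] at h2 h2'
  have hm := hF.iterate_mem h2 hE
  have hnot : ∀ i, 2 ≤ i → i ≤ n → E i ∉ F (i + 1) := fun i hi hin =>
    hF.iterate_notMem ha h2 h2' hE (t := i + 2)
      (fun s _ i j hi hj hij x hx y hy => hij ▸ hF.lie_mem_add hn hi hj hx hy) i hi le_rfl hin
  obtain ⟨r, hr⟩ := hF.exists_sub_smul_mem (by norm_num) (hm 5 (by norm_num))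
    (hnot 5 (by norm_num) (by omega)) (hF.lie_two_three h2 (hm 3 (by norm_num)))
  have hr0 : r ≠ 0 := by
    rintro rfl
    rw [zero_smul, sub_zero] at hr
    refine hA fun x hx y hy => ?_
    obtain ⟨c, hc⟩ := hF.exists_sub_smul_mem (by norm_num) h2 h2' hx
    obtain ⟨d, hd⟩ := hF.exists_sub_smul_mem (by norm_num) (hm 3 (by norm_num))
      (hnot 3 (by norm_num) (by omega)) hy
    have h3 := hF.lie_mem_add hn (by norm_num) (by norm_num) hc hy
    have h4 := hF.lie_mem_add hn (by norm_num) (by norm_num) h2 hd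
    have h5 := add_mem h3 ((F 6).smul_mem c (add_mem h4 ((F 6).smul_mem d hr)))
    convert h5 using 1
    simp only [sub_lie, lie_sub, smul_lie, lie_smul]
    module
  -- The factorial turns `[a, E i] = E (i + 1)` into the factor `i - 1`. A common scale `c` must
  -- satisfy `c² r = c / 3!` for `[e 2, e 3] ≡ e 5`, hence `c = (6 r)⁻¹`.
  have hne : ∀ i : ℕ, (6 * r)⁻¹ * ((i - 2).factorial : k)⁻¹ ≠ 0 := fun i =>
    mul_ne_zero (inv_ne_zero (mul_ne_zero (by norm_num) hr0))
      (inv_ne_zero (by exact_mod_cast Nat.factorial_ne_zero _))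
  let e : ℕ → L := fun i => if i = 1 then a else ((6 * r)⁻¹ * ((i - 2).factorial : k)⁻¹) • E i
  have e1 : e 1 = a := by simp [e]
  have ei : ∀ i, 2 ≤ i → e i = ((6 * r)⁻¹ * ((i - 2).factorial : k)⁻¹) • E i := by
    intro i hi
    simp [e, show i ≠ 1 by omega]
  refine ⟨e, fun i hi => ?_, fun i hi hin => ?_, fun i hi => ?_, ?_⟩
  · rcases Nat.eq_or_lt_of_le hi with rfl | hi
    · exact hF.mem_one _
    · rw [ei i hi]
      exact (F i).smul_mem _ (hm i hi)
  · rcases Nat.eq_or_lt_of_le hi with rfl | hi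
    · rwa [e1]
    · rw [ei i hi, Submodule.smul_mem_iff _ (hne i)]
      exact hnot i hi hin
  · obtain ⟨j, rfl⟩ := Nat.exists_eq_add_of_le' hi
    rw [e1, ei _ hi, ei _ (by omega), lie_smul, ← hE _ hi, smul_smul]
    congr 1
    have hj : (j : k) + 1 ≠ 0 := Nat.cast_add_one_ne_zero j
    have hj' : (j.factorial : k) ≠ 0 := by exact_mod_cast Nat.factorial_ne_zero j
    rw [show j + 2 + 1 - 2 = j + 1 by omega, show j + 2 - 2 = j by omega, Nat.factorial_succ]
    push_cast
    rw [show (j : k) + 2 - 1 = j + 1 by ring]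
    field_simp
  · rw [ei 2 le_rfl, ei 3 (by norm_num), ei 5 (by norm_num)]
    convert (F 6).smul_mem ((6 * r)⁻¹ * (6 * r)⁻¹) hr using 1
    simp only [smul_lie, lie_smul, smul_sub, smul_smul]
    congr 2
    · simp
    · norm_num [Nat.factorial]
      field_simp

/-- Properties (a) and not (c), expressed in terms of the flag, force an adapted basis of Witt
type. -/
theorem exists_isWittAdapted (hF : IsFiliformFlag n F) (hn : 12 ≤ n)
    (hA : ¬ ∀ x ∈ F 2, ∀ y ∈ F 3, ⁅x, y⁆ ∈ F 6) (hC : ¬ ∀ x ∈ F 3, ∀ y ∈ F 3, ⁅x, y⁆ ∈ F 8) :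
    ∃ e : ℕ → L, IsWittAdapted n F e ∧
      ∀ i, 2 ≤ i → ⁅e 1, e i⁆ = ((i : k) - 1) • e (i + 1) := by
  obtain ⟨e, hm, hnot, he, h23⟩ := hF.exists_basis (by omega) hA
  have hlie := fun {i j : ℕ} {x y : L} => hF.lie_mem_add_of_pos (by omega : 6 ≤ n)
    (i := i) (j := j) (x := x) (y := y)
  have hψ : ∀ s, 1 ≤ s → ∃ ψ : L →ₗ[k] k, (s ≤ n → ψ (e s) = 1) ∧ (∀ x ∈ F (s + 1), ψ x = 0) ∧
      ∀ x ∈ F s, x - ψ x • e s ∈ F (s + 1) := by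
    intro s hs
    rcases Nat.lt_or_ge n s with hsn | hsn
    · refine ⟨0, fun h => absurd h (by omega), fun _ _ => rfl, fun x hx => ?_⟩
      rw [hF.eq_zero hsn hx]
      simp
    · obtain ⟨ψ, h1, h2⟩ := hF.exists_functional hs (hm s hs) (hnot s hs hsn)
      exact ⟨ψ, fun _ => h1, h2⟩
  choose! ψ hψ1 hψ0 hψ using hψ
  have hψlie : ∀ i m, 1 ≤ i → 1 ≤ m → ∀ x ∈ F m,
      ψ (i + m) ⁅e i, x⁆ = ψ m x * ψ (i + m) ⁅e i, e m⁆ := by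
    intro i m hi hmm x hx
    have h0 : ⁅e i, x - ψ m x • e m⁆ ∈ F (i + (m + 1)) :=
      hlie hi (by omega) (hm i hi) (hψ m hmm x hx)
    have h1 := hψ0 (i + m) (by omega) _ h0
    rw [lie_sub, lie_smul, map_sub, map_smul, smul_eq_mul] at h1
    exact sub_eq_zero.1 h1
  let g : ℕ → ℕ → k := fun i j => ψ (i + j) ⁅e i, e j⁆
  have hanti : ∀ i j, g i j = -g j i := by
    intro i j
    simp only [g]
    rw [← lie_skew, map_neg, add_comm]
  have hg1 : ∀ i j, 2 ≤ i → 2 ≤ j → i + j + 1 ≤ n →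
      ((i : k) + j - 1) * g i j = (i - 1) * g (i + 1) j + (j - 1) * g i (j + 1) := by
    intro i j hi hj hij
    have h1 := hψlie 1 (i + j) le_rfl (by omega) _
      (hlie (by omega) (by omega) (hm i (by omega)) (hm j (by omega)))
    rw [leibniz_lie, he i hi, he j hj, he (i + j) (by omega), smul_lie, lie_smul, map_add,
      map_smul, map_smul, map_smul, show 1 + (i + j) = i + j + 1 by omega,
      hψ1 (i + j + 1) (by omega) hij] at h1
    simp only [g]
    rw [show i + 1 + j = i + j + 1 by omega, show i + (j + 1) = i + j + 1 by omega]
    simp only [smul_eq_mul] at h1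
    push_cast at h1
    linear_combination -h1
  have hgJ : ∀ i j l, 2 ≤ i → 2 ≤ j → 2 ≤ l → i + j + l ≤ n →
      g j l * g i (j + l) + g l i * g j (l + i) + g i j * g l (i + j) = 0 := by
    intro i j l hi hj hl _
    have h1 : ∀ i j l, 2 ≤ i → 2 ≤ j → 2 ≤ l →
        g j l * g i (j + l) = ψ (i + (j + l)) ⁅e i, ⁅e j, e l⁆⁆ := by
      intro i j l hi hj hl
      exact (hψlie i (j + l) (by omega) (by omega) _
        (hlie (by omega) (by omega) (hm j (by omega)) (hm l (by omega)))).symm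
    rw [h1 i j l hi hj hl, h1 j l i hj hl hi, h1 l i j hl hi hj,
      show j + (l + i) = i + (j + l) by omega, show l + (i + j) = i + (j + l) by omega,
      ← map_add, ← map_add, lie_jacobi, map_zero]
  have hg23 : g 2 3 = 1 := by
    have h1 := hψ0 5 (by norm_num) _ h23
    rw [map_sub, hψ1 5 (by norm_num) (by omega)] at h1
    exact sub_eq_zero.1 h1
  -- Modulo `[F 4, F 4] ⊆ F 8`, brackets in `F 3` reduce to `[e 3, F 4]`, whose only possible term
  -- below degree 8 comes from `[e 3, e 4]`.
  have hg34 : g 3 4 ≠ 0 := by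
    intro h0
    have h34 : ⁅e 3, e 4⁆ ∈ F 8 := by
      have h1 := hψ 7 (by norm_num) _ (hlie (by norm_num) (by norm_num) (hm 3 (by norm_num))
        (hm 4 (by norm_num)))
      rw [show ψ 7 ⁅e 3, e 4⁆ = 0 from h0, zero_smul, sub_zero] at h1
      exact h1
    have h3y : ∀ y ∈ F 4, ⁅e 3, y⁆ ∈ F 8 := by
      intro y hy
      have h1 := hlie (by norm_num) (by norm_num) (hm 3 (by norm_num)) (hψ 4 (by norm_num) y hy)
      have h2 := add_mem h1 ((F 8).smul_mem (ψ 4 y) h34)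
      simpa using h2
    refine hC fun x hx y hy => ?_
    have hx' := hψ 3 (by norm_num) x hx
    have hy' := hψ 3 (by norm_num) y hy
    have h1 := hlie (by norm_num) (by norm_num) hx' hy'
    have h2 := h3y _ hx'
    have h4 := h3y _ hy'
    have h5 := add_mem (sub_mem h1 ((F 8).smul_mem (ψ 3 y) h2)) ((F 8).smul_mem (ψ 3 x) h4)
    convert h5 using 1
    rw [← lie_skew (e 3) (x - _)]
    simp only [sub_lie, lie_sub, smul_lie, lie_smul, lie_self]
    module
  have hg := structureConstants_eq hn hanti hg1 hgJ hg23 hg34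
  refine ⟨e, ⟨hF.toIsFullFlag, hlie, hm, hnot, fun i j hi hj => ?_⟩, he⟩
  rcases Nat.lt_or_ge n (i + j) with hij | hij
  · rw [hF.eq_zero hij (hlie hi hj (hm i hi) (hm j hj)), hF.eq_zero hij (hm (i + j) (by omega))]
    simp
  rcases Nat.eq_or_lt_of_le hi with rfl | hi'
  · rcases Nat.eq_or_lt_of_le hj with rfl | hj'
    · simp
    · rw [he j hj', add_comm 1 j]
      simp
  rcases Nat.eq_or_lt_of_le hj with rfl | hj'
  · rw [← lie_skew, he i hi', ← neg_smul, neg_sub]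
    simp
  · rw [← hg i j hi' hj' hij]
    exact hψ (i + j) (by omega) _ (hlie hi hj (hm i hi) (hm j hj))

end IsFiliformFlag

end WittAdapted

end Filiform

/-! ### The flag of a filiform algebra from its lower central series. -/

namespace Filiform

section LowerCentralSeries

variable {k : Type*} {L : Type*} [Field k] [LieRing L] [LieAlgebra k L]

theorem lie_mem_lcs_succ (x : L) {i : ℕ} {y : L} (hy : y ∈ lcs k L i) :
    ⁅x, y⁆ ∈ lcs k L (i + 1) := by
  rw [lcs, LieModule.lowerCentralSeries_succ]
  exact LieSubmodule.lie_mem_lie (LieSubmodule.mem_top x) hy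

theorem lcs_succ_le {i : ℕ} (S : Submodule k L) (h : ∀ x : L, ∀ y ∈ lcs k L i, ⁅x, y⁆ ∈ S) :
    (lcs k L (i + 1)).toSubmodule ≤ S := by
  rw [lcs, LieModule.lowerCentralSeries_succ, LieSubmodule.lieIdeal_oper_eq_linear_span',
    Submodule.span_le]
  rintro _ ⟨x, -, y, hy, rfl⟩
  exact h x y hy

theorem lcs_antitone : Antitone (lcs k L) := LieModule.antitone_lowerCentralSeries k L L

theorem lie_mem_lcs (i : ℕ) : ∀ (j : ℕ) {x y : L}, x ∈ lcs k L i → y ∈ lcs k L j →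
    ⁅x, y⁆ ∈ lcs k L (i + j + 1) := by
  induction i with
  | zero =>
    intro j x y _ hy
    rw [zero_add]
    exact lie_mem_lcs_succ x hy
  | succ i ih =>
    intro j x y hx hy
    have hle : (lcs k L (i + 1)).toSubmodule ≤ (lcs k L (i + 1 + j + 1)).toSubmodule.comap
        ((LieModule.toEnd k L L y : L →ₗ[k] L)) := by
      refine lcs_succ_le _ fun u v hv => ?_
      rw [Submodule.mem_comap, LieModule.toEnd_apply_apply, ← lie_skew, lie_lie]
      refine neg_mem (sub_mem ?_ ?_)
      · have := lie_mem_lcs_succ u (ih j hv hy)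
        rwa [show i + j + 1 + 1 = i + 1 + j + 1 by omega] at this
      · have := ih (j + 1) hv (lie_mem_lcs_succ u hy)
        rwa [show i + (j + 1) + 1 = i + 1 + j + 1 by omega] at this
    have h1 : ⁅y, x⁆ ∈ lcs k L (i + 1 + j + 1) := hle hx
    rw [← lie_skew]
    exact neg_mem h1

theorem lcs_lt_of_nilindex {p : ℕ} (hp : HasNilindex k L p) {i : ℕ} (hi : i < p) :
    (lcs k L (i + 1)).toSubmodule < (lcs k L i).toSubmodule := by
  refine lt_of_le_of_ne (lcs_antitone (Nat.le_succ i)) fun h => ?_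
  have h' : lcs k L (i + 1) = lcs k L i := LieSubmodule.toSubmodule_injective h
  have hstep : ∀ d, lcs k L (i + d) = lcs k L i := by
    intro d
    induction d with
    | zero => rfl
    | succ d ih =>
      rw [← h', lcs, lcs, ← add_assoc, LieModule.lowerCentralSeries_succ,
        LieModule.lowerCentralSeries_succ]
      rw [lcs, lcs] at ih
      rw [ih]
  have h2 := hstep (p - i)
  rw [show i + (p - i) = p by omega, hp.1] at h2
  exact hp.2 i hi h2.symm

variable [Module.Finite k L]

/-- If `L = k g + L^1`, then `[g, g] = 0` gives `[L, L] ⊆ [L, L^1]`, so `L^1 = L^2`, against strict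
descent. -/
theorem finrank_lcs_one_add_two_le {p : ℕ} (hp : HasNilindex k L p) (hp2 : 2 ≤ p) :
    Module.finrank k (lcs k L 1).toSubmodule + 2 ≤ Module.finrank k L := by
  by_contra hlt
  have h0 : (lcs k L 1).toSubmodule < _ := lcs_lt_of_nilindex hp (by omega : 0 < p)
  obtain ⟨g, -, hg⟩ := SetLike.exists_of_lt h0
  have hle : (lcs k L 1).toSubmodule ≤ (lcs k L 2).toSubmodule := by
    refine lcs_succ_le _ fun x y _ => ?_
    have hdec : ∀ x : L, ∃ c : k, x - c • g ∈ (lcs k L 1).toSubmodule := fun x =>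
      exists_sub_smul_mem_of_finrank le_top (by rw [finrank_top]; omega) Submodule.mem_top hg
        Submodule.mem_top
    obtain ⟨c, hc⟩ := hdec x
    obtain ⟨d, hd⟩ := hdec y
    have h1 : ⁅y, x - c • g⁆ ∈ lcs k L 2 := lie_mem_lcs_succ y hc
    have h2 : ⁅g, y - d • g⁆ ∈ lcs k L 2 := lie_mem_lcs_succ g hd
    have h3 := sub_mem ((lcs k L 2).toSubmodule.smul_mem c h2) h1
    convert h3 using 1
    rw [← lie_skew x y]
    simp only [lie_sub, lie_smul, lie_self]
    rw [← lie_skew y g]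
    module
  exact absurd hle (lcs_lt_of_nilindex hp (by omega : 1 < p)).not_ge

/-- There are `p` strict drops from dimension `p + 1` to zero and the first is at least two, so
every later drop is exactly one. -/
theorem finrank_lcs {n : ℕ} (hL : IsFiliform k L n) (hn : 3 ≤ n) {i : ℕ} (hi : 1 ≤ i) :
    Module.finrank k (lcs k L i).toSubmodule = n - 1 - i := by
  obtain ⟨-, hd, p, rfl, hp⟩ := hL
  have hlt : ∀ i < p, Module.finrank k (lcs k L (i + 1)).toSubmodule <
      Module.finrank k (lcs k L i).toSubmodule := fun i hi =>
    Submodule.finrank_lt_finrank_of_lt (lcs_lt_of_nilindex hp hi)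
  have hlow : ∀ d ≤ p, d ≤ Module.finrank k (lcs k L (p - d)).toSubmodule := by
    intro d
    induction d with
    | zero => intro _; exact Nat.zero_le _
    | succ d ih =>
      intro hd
      have h1 := ih (by omega)
      have h2 := hlt (p - (d + 1)) (by omega)
      rw [show p - (d + 1) + 1 = p - d by omega] at h2
      omega
  have hup : ∀ d, d + 1 ≤ p → Module.finrank k (lcs k L (d + 1)).toSubmodule + (d + 2) ≤ p + 1 := by
    intro d
    induction d with
    | zero => intro _; rw [← hd]; exact finrank_lcs_one_add_two_le hp (by omega)
    | succ d ih =>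
      intro hd
      have h1 := ih (by omega)
      have h2 := hlt (d + 1) (by omega)
      omega
  rcases Nat.lt_or_ge p i with hip | hip
  · have h1 : lcs k L i ≤ lcs k L p := lcs_antitone hip.le
    rw [hp.1, le_bot_iff] at h1
    rw [h1, LieSubmodule.bot_toSubmodule, finrank_bot]
    omega
  · have h1 := hlow (p - i) (by omega)
    have h2 := hup (i - 1) (by omega)
    rw [show p - (p - i) = i by omega] at h1
    rw [Nat.sub_add_cancel hi] at h2
    omega

/-- The flag formed by `U` and the lower central series. -/
def lcsFlag (U : Submodule k L) : ℕ → Submodule k L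
  | 0 => ⊤
  | 1 => ⊤
  | 2 => U
  | i + 3 => (lcs k L (i + 1)).toSubmodule

omit [Module.Finite k L] in
theorem lcsFlag_eq (U : Submodule k L) {i : ℕ} (hi : 3 ≤ i) :
    lcsFlag U i = (lcs k L (i - 2)).toSubmodule := by
  obtain ⟨j, rfl⟩ := Nat.exists_eq_add_of_le' hi
  rfl

/-- The two-step centralizer: a hyperplane mapping `L^1` to `L^3`. -/
theorem exists_twoStepCentralizer {n : ℕ} (hL : IsFiliform k L n) (hn : 5 ≤ n) :
    ∃ U : Submodule k L, (lcs k L 1).toSubmodule ≤ U ∧ Module.finrank k U = n - 1 ∧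
      (∀ x ∈ U, ∀ y ∈ lcs k L 1, ⁅x, y⁆ ∈ lcs k L 3) ∧
      ∃ a : L, a ∉ U ∧ ∀ x : L, ∃ c : k, x - c • a ∈ U := by
  obtain ⟨-, hd, p, hpn, hp⟩ := id hL
  have hr : ∀ i, 1 ≤ i → _ := fun i hi => finrank_lcs hL (by omega) (i := i) hi
  obtain ⟨g, hg, hg'⟩ := SetLike.exists_of_lt (lcs_lt_of_nilindex hp (by omega : 1 < p))
  have hdec : ∀ y ∈ lcs k L 1, ∃ c : k, y - c • g ∈ (lcs k L 2).toSubmodule := fun y hy =>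
    exists_sub_smul_mem_of_finrank (lcs_antitone (by norm_num))
      (by rw [hr 1 le_rfl, hr 2 (by norm_num)]; omega) hg hg' hy
  -- `L^1 / L^2` is a line spanned by `g`, so centralizing `L^1` modulo `L^3` is a condition on `g`
  -- alone, with values in the line `L^2 / L^3`.
  let U : Submodule k L := (lcs k L 3).toSubmodule.comap (LieModule.toEnd k L L g : L →ₗ[k] L)
  have hU : ∀ x, x ∈ U ↔ ⁅g, x⁆ ∈ lcs k L 3 := fun x => Iff.rfl
  have hU' : ∀ x ∈ U, ∀ y ∈ lcs k L 1, ⁅x, y⁆ ∈ lcs k L 3 := by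
    intro x hx y hy
    obtain ⟨c, hc⟩ := hdec y hy
    have h1 : ⁅x, y - c • g⁆ ∈ lcs k L 3 := lie_mem_lcs_succ x hc
    have h2 := sub_mem h1 ((lcs k L 3).toSubmodule.smul_mem c ((hU x).1 hx))
    convert h2 using 1
    rw [← lie_skew g x]
    simp only [lie_sub, lie_smul]
    module
  have hex : ∃ a, a ∉ U := by
    by_contra! h
    have hle : (lcs k L 2).toSubmodule ≤ (lcs k L 3).toSubmodule :=
      lcs_succ_le _ fun x y hy => hU' x (h x) y hy
    exact absurd hle (lcs_lt_of_nilindex hp (by omega : 2 < p)).not_ge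
  obtain ⟨a, ha⟩ := hex
  have hg2 : ∀ x : L, ⁅g, x⁆ ∈ lcs k L 2 := by
    intro x
    rw [← lie_skew]
    exact neg_mem (lie_mem_lcs_succ x hg)
  have hdecU : ∀ x : L, ∃ c : k, x - c • a ∈ U := by
    intro x
    obtain ⟨c, hc⟩ := exists_sub_smul_mem_of_finrank (A := (lcs k L 3).toSubmodule)
      (B := (lcs k L 2).toSubmodule) (lcs_antitone (by norm_num))
      (by rw [hr 2 (by norm_num), hr 3 (by norm_num)]; omega) (hg2 a) ha (hg2 x)
    refine ⟨c, (hU _).2 ?_⟩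
    rw [lie_sub, lie_smul]
    exact hc
  refine ⟨U, fun x hx => ?_, ?_, hU', a, ha, hdecU⟩
  · exact lie_mem_lcs 1 1 hg hx
  · have hsup : U ⊔ Submodule.span k {a} = ⊤ := by
      rw [eq_top_iff]
      intro x _
      obtain ⟨c, hc⟩ := hdecU x
      rw [Submodule.mem_sup]
      exact ⟨_, hc, c • a, Submodule.smul_mem _ _ (Submodule.mem_span_singleton_self a), by simp⟩
    have h1 := Submodule.finrank_add_le_finrank_add_finrank U (Submodule.span k {a})
    have ha0 : a ≠ 0 := by
      rintro rfl
      exact ha (zero_mem _)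
    rw [hsup, finrank_top, finrank_span_singleton ha0, hd] at h1
    have h2 := Submodule.finrank_lt (s := U) (fun h => ha (h ▸ Submodule.mem_top))
    rw [hd] at h2
    omega

theorem isFiliformFlag_lcsFlag {n : ℕ} (hL : IsFiliform k L n) (hn : 5 ≤ n)
    (hB : PropertyB k L n) {U : Submodule k L} (hU1 : (lcs k L 1).toSubmodule ≤ U)
    (hUn : Module.finrank k U = n - 1) (hU : ∀ x ∈ U, ∀ y ∈ lcs k L 1, ⁅x, y⁆ ∈ lcs k L 3)
    {a : L} (ha : ∀ x : L, ∃ c : k, x - c • a ∈ U) : IsFiliformFlag n (lcsFlag U) := by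
  have hlie : ∀ {i : ℕ} (x : L) {y : L}, 2 ≤ i → y ∈ lcsFlag U i → ⁅x, y⁆ ∈ lcsFlag U (i + 1) := by
    intro i x y hi hy
    rcases Nat.eq_or_lt_of_le hi with rfl | hi
    · exact lie_mem_lcs_succ (i := 0) x (LieSubmodule.mem_top y)
    · obtain ⟨j, rfl⟩ := Nat.exists_eq_add_of_le' hi
      exact lie_mem_lcs_succ x hy
  refine ⟨⟨antitone_nat_of_succ_le fun i => ?_, rfl, fun i hi => ?_⟩, hlie, ?_, ?_, ?_, ?_⟩
  · match i with
    | 0 => exact le_top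
    | 1 => exact le_top
    | 2 => exact hU1
    | i + 3 => exact lcs_antitone (Nat.le_succ (i + 1))
  · match i, hi with
    | 1, _ =>
      rw [show lcsFlag U 1 = ⊤ from rfl, finrank_top, hL.2.1]
      omega
    | 2, _ =>
      rw [show lcsFlag U 2 = U from rfl, hUn]
      omega
    | i + 3, _ =>
      rw [show lcsFlag U (i + 3) = (lcs k L (i + 1)).toSubmodule from rfl,
        finrank_lcs hL (by omega) (by omega)]
      omega
  · intro i j x y hi hj hx hy
    rcases Nat.eq_or_lt_of_le hi with rfl | hi'
    · have := hlie x hj hy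
      rwa [show 2 + j - 1 = j + 1 by omega]
    rcases Nat.eq_or_lt_of_le hj with rfl | hj'
    · rw [← lie_skew]
      exact neg_mem (hlie y hi hx)
    · obtain ⟨i, rfl⟩ := Nat.exists_eq_add_of_le' hi'
      obtain ⟨j, rfl⟩ := Nat.exists_eq_add_of_le' hj'
      have := lie_mem_lcs (i + 1) (j + 1) hx hy
      rw [lcsFlag_eq U (by omega), show i + 3 + (j + 3) - 1 - 2 = i + 1 + (j + 1) + 1 by omega]
      exact this
  · intro i S hi h
    rcases Nat.eq_or_lt_of_le hi with rfl | hi'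
    · refine lcs_succ_le (i := 0) S fun x y _ => ?_
      obtain ⟨c, hc⟩ := ha x
      obtain ⟨d, hd⟩ := ha y
      have h1 := h y _ hc
      have h2 := h a _ hd
      have h3 := sub_mem (S.smul_mem c h2) h1
      convert h3 using 1
      rw [← lie_skew x y]
      simp only [lie_sub, lie_smul, lie_self]
      rw [← lie_skew y a]
      module
    · obtain ⟨j, rfl⟩ := Nat.exists_eq_add_of_le' hi'
      exact lcs_succ_le S h
  · intro x y hx hy
    exact hU x hx y hy
  · intro p x y hp hnp hx hy
    obtain ⟨q, rfl⟩ := Nat.exists_eq_add_of_le' hp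
    have hab := hB (q + 1) (by omega)
    have := hab.trivial ⟨x, hx⟩ ⟨y, hy⟩
    exact congrArg Subtype.val this

end LowerCentralSeries

end Filiform

/-! ### The equivalence. -/

theorem mainTheorem9 {k : Type*} [Field k] [CharZero k]
    {L : Type*} [LieRing L] [LieAlgebra k L]
    (n : ℕ) (hn : 12 ≤ n) (hL : Filiform.InClassA2 k L n) :
    Filiform.HasNonsingularPrederivation k L ↔ Filiform.HasNonsingularDerivation k L := by
  constructor
  · rintro ⟨P, hP, hbij⟩
    obtain ⟨hfil, hA, hB, hC⟩ := hL
    have : Module.Finite k L := hfil.1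
    obtain ⟨U, hU1, hUn, hU, a, -, ha⟩ := Filiform.exists_twoStepCentralizer hfil (by omega)
    have hF := Filiform.isFiliformFlag_lcsFlag hfil (by omega) hB hU1 hUn hU ha
    -- With `F 2 = U`, `F 3 = L^1`, `F 6 = L^4` and `F 8 = L^6`, the two flag conditions are (a)
    -- tested on `U` and the negation of (c).
    obtain ⟨e, hW, he⟩ := hF.exists_isWittAdapted hn
      (fun h => hA ⟨U, hU1, by
        have := Submodule.finrank_quotient_add_finrank U
        rw [hUn, hfil.2.1] at this
        omega, h⟩)
      (fun h => hC ((LieSubmodule.lie_le_iff _ _ _).2 h))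
    obtain ⟨m, rfl⟩ : ∃ m, n = m + 5 := ⟨n - 5, by omega⟩
    exact hW.hasNonsingularDerivation_of_prederivation (by omega) he hP hbij.1
  · rintro ⟨D, hD⟩
    refine ⟨D, fun x y z => ?_, hD⟩
    simp only [LieDerivation.coeFn_coe, LieDerivation.apply_lie_eq_add, lie_add]
    abel
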